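/- Let $R$ be an integral domain (for example $\mathbb{Z}$ or $\mathbb{R}$); all cohomology has coefficients in $R$ and $\operatorname{rank}$ is the rank of an $R$-module. Let $K$ be a simplicial complex on $[m]=\{1,\dots,m\}$ with $\varnothing\in K$ and $\{i\}\in K$ for all $i\in[m]$. For $I\subset[m]$ let $K_I=\{\sigma\in K:\sigma\subset I\}$ be the full subcomplex on $I$, and let $\widetilde H^p(K_I)$, $p\ge -1$, be its reduced simplicial cohomology (so $\widetilde H^{*}(K_\varnothing)=\widetilde H^{-1}(K_\varnothing)=R$). The cohomology of the moment-angle complex $\mathcal Z_K$ is identified, by Hochster's decomposition, with $\bigoplus_{p\ge-1}\bigoplus_{I\subset[m]}\widetilde H^p(K_I)$. For $i\in I$ let $\psi_{p;i,I}:\widetilde H^p(K_I)\to\widetilde H^p(K_{I\setminus\{i\}})$ be induced by inclusion, let $\varepsilon(i,I)=(-1)^{\#\{l\in I:\,l<i\}}$, and let $d'$ be the differential which on $\widetilde H^p(K_I)$ is $(-1)^{p+1}\sum_{i\in I}\varepsilon(i,I)\,\psi_{p;i,I}$. The double cohomology is $HH^*(\mathcal Z_K)=\ker d'/\operatorname{im}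 d'$. **Theorem.** Let $m\ge n+2\ge 3$ and let $K$ be as above. Suppose that 1. $[n+1]\notin K$; 2. for every $J=[n+1]\cup\{j\}$ with $n+2\le j\le m$, and every $1\le i\le n+1$, $J\setminus\{i\}\in K$; 3. for every $J=[n+1]\cup\{j,k\}$ with $n+2\le j<k\le m$, $\operatorname{rank}\widetilde H^n(K_J)\le 1$; 4. for every $J=[n+1]\cup\{j,k\}$ with $n+2\le j<k\le m$, either $J\setminus\{i\}\in K$ for all $1\le i\le n+1$, or $J\setminus\{i\}\notin K$ for all $1\le i\le n+1$. Let $\lambda K=K\cup\{[n+1]\}$ be obtained from $K$ by gluing an $n$-simplex on $[n+1]$ along its boundary. Then 1. $\operatorname{rank}HH^*(\mathcal Z_{\lambda K})=\operatorname{rank}HH^*(\mathcal Z_K)-2$ if there is some $J=[n+1]\cup\{j,k\}$ with $n+2\le j<k\le m$ and $\operatorname{rank}\widetilde H^n(K_J)=1$; 2. $\operatorname{rank}HH^*(\mathcal Z_{\lambda K})=\operatorname{rank}HH^*(\mathcal Z_K)$ otherwise. -/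

import Mathlib

open scoped DirectSum

namespace MomentAngle

noncomputable section

universe u

variable {V : Type}

/-- The full subcomplex `K_I`. -/
def fullSubcomplex (K : PreAbstractSimplicialComplex V) (I : Finset V) :
    PreAbstractSimplicialComplex V where
  faces := {σ | σ ∈ K ∧ σ ⊆ I}
  isRelLowerSet_faces := fun _ hσ =>
    ⟨(K.isRelLowerSet_faces hσ.1).1, fun _ hτσ hτ =>
      ⟨(K.isRelLowerSet_faces hσ.1).2 hτσ hτ, Finset.Subset.trans hτσ hσ.2⟩⟩

theorem fullSubcomplex_mono (K : PreAbstractSimplicialComplex V) {I J : Finset V} (h : I ⊆ J) :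
    fullSubcomplex K I ≤ fullSubcomplex K J :=
  fun _ hσ => ⟨hσ.1, Finset.Subset.trans hσ.2 h⟩

/-- The complex `λ_s K = K ∪ Δ_s` obtained from `K` by adding the simplex on `s` (together with
all of its faces). When the proper nonempty subsets of `s` are faces of `K`, this glues the simplex
along its boundary, and the faces are those of `K` and `s` itself. -/
def glueSimplex (K : AbstractSimplicialComplex V) (s : Finset V) :
    AbstractSimplicialComplex V where
  faces := {σ | σ ∈ K.faces ∨ (σ.Nonempty ∧ σ ⊆ s)}
  isRelLowerSet_faces := by
    rintro σ (hσ | ⟨hσ, hs⟩)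
    · exact ⟨(K.isRelLowerSet_faces hσ).1, fun _ hτσ hτ =>
        Or.inl ((K.isRelLowerSet_faces hσ).2 hτσ hτ)⟩
    · exact ⟨hσ, fun _ hτσ hτ => Or.inr ⟨hτ, Finset.Subset.trans hτσ hs⟩⟩
  singleton_mem v := Or.inl (K.singleton_mem v)

/-- The set `[n+1]` of the first `n + 1` elements of `[m]`. -/
def initialFace (m n : ℕ) : Finset (Fin m) := Finset.univ.filter fun i => i.val < n + 1

/-- The cohomology `ker g / im f` at `N` of `M → N → P`. -/
abbrev CohomologyAt {R : Type u} [CommRing R] {M N P : Type u} [AddCommGroup M] [AddCommGroup N]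
    [AddCommGroup P] [Module R M] [Module R N] [Module R P] (f : M →ₗ[R] N) (g : N →ₗ[R] P) :
    Type u :=
  LinearMap.ker g ⧸ (LinearMap.range f).submoduleOf (LinearMap.ker g)

variable [LinearOrder V]

/-- The sign `ε(v, I) = (-1)^{#{i ∈ I : i < v}}`. -/
def eps (v : V) (I : Finset V) : ℤ := (-1) ^ (I.filter (· < v)).card

/-- The `p`-dimensional simplices of `K`, the empty set being the unique simplex of
dimension `-1` (it is never listed among `K.faces`). -/
abbrev Simplex (K : PreAbstractSimplicialComplex V) (p : ℤ) : Type :=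
  {σ : Finset V // (σ = ∅ ∨ σ ∈ K) ∧ (σ.card : ℤ) = p + 1}

theorem erase_simplex {K : PreAbstractSimplicialComplex V} {p q : ℤ} (h : p + 1 = q)
    (τ : Simplex K q) (v : {v // v ∈ τ.1}) :
    (τ.1.erase v = ∅ ∨ τ.1.erase v ∈ K) ∧ ((τ.1.erase v).card : ℤ) = p + 1 := by
  obtain ⟨τ, hτ, hc⟩ := τ
  obtain ⟨v, hv⟩ := v
  dsimp only at hv ⊢
  constructor
  · rcases hτ with rfl | hτ
    · simp at hv
    · rcases (τ.erase v).eq_empty_or_nonempty with h0 | h0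
      · exact Or.inl h0
      · exact Or.inr ((K.isRelLowerSet_faces hτ).2 (Finset.erase_subset _ _) h0)
  · have := Finset.card_erase_add_one hv
    omega

/-- Augmented simplicial cochains with coefficients in `R`. -/
abbrev Cochain (R : Type u) (K : PreAbstractSimplicialComplex V) (p : ℤ) : Type u :=
  Simplex K p → R

variable (R : Type u) [CommRing R]

/-- The simplicial coboundary `C^p(K) → C^q(K)`, `q = p + 1`:
`(δ f)(τ) = ∑_{v ∈ τ} ε(v, τ) f(τ \ {v})`. -/
def coboundary (K : PreAbstractSimplicialComplex V) (p q : ℤ) (h : p + 1 = q) :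
    Cochain R K p →ₗ[R] Cochain R K q where
  toFun f τ := ∑ v : {v // v ∈ τ.1}, eps v.1 τ.1 • f ⟨τ.1.erase v, erase_simplex h τ v⟩
  map_add' f g := by
    funext τ
    simp [Finset.sum_add_distrib]
  map_smul' c f := by
    funext τ
    simp [Finset.mul_sum, mul_left_comm]

/-- The reduced simplicial cohomology `H̃^p(K; R) = ker δ^p / im δ^{p-1}`. -/
def ReducedCohomology (K : PreAbstractSimplicialComplex V) (p : ℤ) : Type u :=
  CohomologyAt (coboundary R K (p - 1) p (sub_add_cancel p 1)) (coboundary R K p (p + 1) rfl)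

instance (K : PreAbstractSimplicialComplex V) (p : ℤ) : AddCommGroup (ReducedCohomology R K p) :=
  inferInstanceAs (AddCommGroup (CohomologyAt _ _))

instance (K : PreAbstractSimplicialComplex V) (p : ℤ) : Module R (ReducedCohomology R K p) :=
  inferInstanceAs (Module R (CohomologyAt _ _))

section Restriction

variable {K L : PreAbstractSimplicialComplex V} (hKL : K ≤ L)

/-- Restriction of cochains to a subcomplex. -/
def cochainRes (p : ℤ) : Cochain R L p →ₗ[R] Cochain R K p where
  toFun f σ := f ⟨σ.1, σ.2.1.imp_right (fun h => hKL h), σ.2.2⟩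
  map_add' _ _ := rfl
  map_smul' _ _ := rfl

theorem cochainRes_coboundary (p q : ℤ) (h : p + 1 = q) (f : Cochain R L p) :
    cochainRes R hKL q (coboundary R L p q h f) =
      coboundary R K p q h (cochainRes R hKL p f) := rfl

/-- The homomorphism `H̃^p(L) → H̃^p(K)` induced by the inclusion `K ⊆ L`. -/
def cohomologyRes (p : ℤ) : ReducedCohomology R L p →ₗ[R] ReducedCohomology R K p :=
  Submodule.mapQ _ _
    ((cochainRes R hKL p).restrict (p := LinearMap.ker (coboundary R L p (p + 1) rfl))
      (q := LinearMap.ker (coboundary R K p (p + 1) rfl)) (fun f hf => by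
        rw [LinearMap.mem_ker] at hf ⊢
        rw [← cochainRes_coboundary, hf, map_zero]))
    (by
      rintro ⟨f, hf⟩ ⟨g, hg⟩
      exact ⟨cochainRes R hKL (p - 1) g, by
        rw [← cochainRes_coboundary, hg]
        rfl⟩)

end Restriction

/-- The degree `p` summand `⨁_{I ⊆ V} H̃^p(K_I)` of `CH^*(Z_K)`, the cohomology of the
moment-angle complex in its Hochster decomposition (a finite direct sum, written as a product). -/
abbrev CH (K : PreAbstractSimplicialComplex V) (p : ℤ) : Type u :=
  (I : Finset V) → ReducedCohomology R (fullSubcomplex K I) p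

variable [Fintype V]

/-- The differential `d'_p`. It sends the summand of `I` to the summands of `I \ {i}`, `i ∈ I`,
by `(-1)^{p+1} ε(i, I) ψ_{p;i,I}`; below, it is written through its component at `J`, where the
summands that contribute are those of `I = J ∪ {i}` with `i ∉ J`. -/
def dPrime (K : PreAbstractSimplicialComplex V) (p : ℤ) : CH R K p →ₗ[R] CH R K p :=
  LinearMap.pi fun J => ((p + 1).negOnePow : ℤ) • ∑ i ∈ Jᶜ, eps i (insert i J) •
    (cohomologyRes R (fullSubcomplex_mono K (Finset.subset_insert i J)) p ∘ₗ
      LinearMap.proj (insert i J))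

/-- The summand `HH^p(Z_K) = ker d'_p / im d'_p` of the double cohomology. -/
abbrev HHDeg (K : PreAbstractSimplicialComplex V) (p : ℤ) : Type u :=
  CohomologyAt (dPrime R K p) (dPrime R K p)

/-- The double cohomology `HH^*(Z_K)` with coefficients in `R`, of a simplicial complex all of
whose one-element sets of vertices are faces. -/
abbrev HH (K : AbstractSimplicialComplex V) : Type u :=
  ⨁ p : ℤ, HHDeg R K.toPreAbstractSimplicialComplex p

end

end MomentAngle

open scoped Cardinal

namespace MomentAngle
noncomputable section
universe u
variable {V : Type} [LinearOrder V]

/-! ### Signs -/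

/-! Write `s` for `[n+1]` and `L` for the glued complex. Restriction of cochains gives chain maps
`CH^p(L) → CH^p(K)` for `d'`, and these are bijective unless `p` is `n - 1` or `n`. The ranks are
compared in these two degrees.

In degree `n - 1` restriction is injective, and its image is the kernel of evaluation on the cycle
`∂s` in the summand `I = s`: for larger `I`, hypothesis 2 makes `∂s` bound a cone. The fundamental
class of `∂s` is a `d'`-cycle outside the image, so gluing lowers the rank by one.

In degree `n` restriction is surjective. Its kernel is generated by the cochain dual to `s` in the
summands `I ⊋ s`, one free generator each. There `d'` is, up to sign, the boundary of the full
simplex on the complement of `s`, with the empty simplex `I = s` cut off. The kernel therefore has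
homology of rank one, which the augmentation `aug` detects. The rank of `HH^n` rises by one if no
nonzero multiple of this class becomes a boundary in `CH^n(L)`, and falls by one otherwise.

If every `J = s ∪ {j, k}` has all `J \ {i}`, `i ∈ s`, in `K`, then `δδ = 0` on `J` forces `aug ∘ d'
= 0`, so the rank rises and the total change is `0` (`aug_dPrime_eq_zero`). If for some `J` no `J \
{i}` is in `K`, then `rank H̃^n(K_J) ≤ 1` supplies an explicit class whose `d'` lies in the kernel
with nonzero augmentation, and the total change is `-2` (`exists_not_isFace`,
`finrank_HHDeg_add_one_eq`). The rank of `H̃^n(K_J)` tells the cases apart: `K_J` is a cone in the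
first, and carries a nonzero suspension class of `∂s` in the second. -/

theorem eps_mul_self (v : V) (I : Finset V) : eps v I * eps v I = 1 := by
  unfold eps
  rw [← pow_add]
  exact Even.neg_one_pow ⟨_, rfl⟩

theorem eps_smul_eps_smul {M : Type*} [AddCommGroup M] (v : V) (I : Finset V) (x : M) :
    eps v I • eps v I • x = x := by
  rw [smul_smul, eps_mul_self, one_smul]

theorem eps_smul_eq_zero {M : Type*} [AddCommGroup M] {v : V} {I : Finset V} {x : M}
    (h : eps v I • x = 0) : x = 0 := by
  rw [← eps_smul_eps_smul v I x, h, smul_zero]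

theorem eps_mul_eps_erase_of_lt {v w : V} {τ : Finset V} (hv : v ∈ τ) (hvw : v < w) :
    eps v τ * eps w (τ.erase v) = -(eps w τ * eps v (τ.erase w)) := by
  have h1 : (τ.erase w).filter (· < v) = τ.filter (· < v) := by
    ext x
    simp only [Finset.mem_filter, Finset.mem_erase]
    constructor
    · rintro ⟨⟨_, h⟩, h'⟩
      exact ⟨h, h'⟩
    · rintro ⟨h, h'⟩
      exact ⟨⟨(h'.trans hvw).ne, h⟩, h'⟩
  have h2 : (τ.filter (· < w)).card = ((τ.erase v).filter (· < w)).card + 1 := by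
    rw [Finset.filter_erase, Finset.card_erase_add_one]
    simp [hv, hvw]
  unfold eps
  rw [h1, h2, pow_succ]
  ring

theorem eps_mul_eps_erase {v w : V} {τ : Finset V} (hv : v ∈ τ) (hw : w ∈ τ) (hvw : v ≠ w) :
    eps v τ * eps w (τ.erase v) = -(eps w τ * eps v (τ.erase w)) := by
  rcases lt_or_gt_of_ne hvw with h | h
  · exact eps_mul_eps_erase_of_lt hv h
  · rw [eps_mul_eps_erase_of_lt hw h, neg_neg]

/-! ### Coboundaries and boundaries of functions on all finite sets of vertices -/

section Global

variable {M : Type*} [AddCommGroup M]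

/-- The coboundary of a function on the finite sets of vertices. -/
def cobd (f : Finset V → M) (τ : Finset V) : M :=
  ∑ v ∈ τ, eps v τ • f (τ.erase v)

/-- Ordered pairs of distinct elements cancel under the swap. This is the common source of `δδ = 0`,
of `∂∂ = 0` and of the vanishing of `aug ∘ d'`. -/
theorem sum_eq_zero_of_antisymm {ι : Type*} [DecidableEq ι] (s : Finset ι) (F : ι → ι → M)
    (hF : ∀ v ∈ s, ∀ w ∈ s, v ≠ w → F v w + F w v = 0) :
    ∑ v ∈ s, ∑ w ∈ s.erase v, F v w = 0 := by
  rw [Finset.sum_sigma']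
  refine Finset.sum_involution (fun x _ => ⟨x.2, x.1⟩) ?_ ?_ ?_ ?_
  · rintro ⟨v, w⟩ h
    simp only [Finset.mem_sigma, Finset.mem_erase] at h
    exact hF v h.1 w h.2.2 (Ne.symm h.2.1)
  · rintro ⟨v, w⟩ h _ h'
    simp only [Finset.mem_sigma, Finset.mem_erase] at h
    simp only [Sigma.mk.injEq] at h'
    exact h.2.1 h'.1
  · rintro ⟨v, w⟩ h
    simp only [Finset.mem_sigma, Finset.mem_erase] at h ⊢
    exact ⟨h.2.2, Ne.symm h.2.1, h.1⟩
  · rintro ⟨v, w⟩ _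
    rfl

theorem cobd_cobd (f : Finset V → M) (τ : Finset V) : cobd (cobd f) τ = 0 := by
  simp only [cobd, Finset.smul_sum, smul_smul]
  refine sum_eq_zero_of_antisymm τ
    (fun v w => (eps v τ * eps w (τ.erase v)) • f ((τ.erase v).erase w)) fun v hv w hw hvw => ?_
  rw [eps_mul_eps_erase hv hw hvw, Finset.erase_right_comm, neg_smul, neg_add_cancel]

theorem cobd_congr {f g : Finset V → M} {τ : Finset V}
    (h : ∀ v ∈ τ, f (τ.erase v) = g (τ.erase v)) : cobd f τ = cobd g τ :=
  Finset.sum_congr rfl fun v hv => by rw [h v hv]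

/-- If all but one of the terms of a coboundary vanish, the coboundary is the remaining one. -/
theorem cobd_eq_single {f : Finset V → M} {τ : Finset V} {v : V} (hv : v ∈ τ)
    (h : ∀ w ∈ τ, w ≠ v → f (τ.erase w) = 0) : cobd f τ = eps v τ • f (τ.erase v) :=
  Finset.sum_eq_single_of_mem v hv fun w hw hwv => by rw [h w hw hwv, smul_zero]

theorem cobd_eq_zero {f : Finset V → M} {τ : Finset V}
    (h : ∀ w ∈ τ, f (τ.erase w) = 0) : cobd f τ = 0 :=
  Finset.sum_eq_zero fun w hw => by rw [h w hw, smul_zero]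

/-- The contraction of the coboundary by the cone with apex `v`. -/
def coneCobd (v : V) (f : Finset V → M) (σ : Finset V) : M :=
  if v ∈ σ then 0 else eps v (insert v σ) • f (insert v σ)

/-- If `v ∈ τ`, only the term of the coboundary that removes `v` survives. If `v ∉ τ`, removing `v`
from `τ ∪ {v}` returns `f τ`, and the remaining terms cancel in pairs by the sign rule. -/
theorem cobd_coneCobd (v : V) (f : Finset V → M) (τ : Finset V) :
    cobd (coneCobd v f) τ + coneCobd v (cobd f) τ = f τ := by
  by_cases hv : v ∈ τ
  · have h1 : coneCobd v (cobd f) τ = 0 := if_pos hv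
    rw [h1, add_zero, cobd_eq_single hv]
    · simp only [coneCobd, Finset.notMem_erase, if_false, Finset.insert_erase hv]
      exact eps_smul_eps_smul v τ _
    · intro w _ hwv
      exact if_pos (Finset.mem_erase.2 ⟨hwv.symm, hv⟩)
  · have h1 : coneCobd v (cobd f) τ = f τ +
        ∑ w ∈ τ, (eps v (insert v τ) * eps w (insert v τ)) • f ((insert v τ).erase w) := by
      simp only [coneCobd, hv, if_false, cobd]
      rw [Finset.sum_insert hv, smul_add, eps_smul_eps_smul, Finset.erase_insert hv]
      simp only [Finset.smul_sum, smul_smul]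
    rw [h1, add_left_comm, add_eq_left, cobd, ← Finset.sum_add_distrib]
    refine Finset.sum_eq_zero fun w hw => ?_
    have hvw : v ≠ w := fun h => hv (h ▸ hw)
    have hv' : v ∉ τ.erase w := fun h => hv (Finset.mem_of_mem_erase h)
    have h2 : (insert v τ).erase w = insert v (τ.erase w) :=
      Finset.erase_insert_of_ne hvw
    have h3 := eps_mul_eps_erase (Finset.mem_insert_self v τ) (Finset.mem_insert_of_mem hw) hvw
    rw [Finset.erase_insert hv, h2] at h3
    simp only [coneCobd, hv', if_false, smul_smul, h2]
    rw [← add_smul]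
    convert zero_smul ℤ _
    have e1 := eps_mul_self v (insert v τ)
    have e2 := eps_mul_self w (insert v τ)
    have e3 := eps_mul_self v (insert v (τ.erase w))
    -- This is the sign rule `h3` multiplied by `ε(v, τ ∪ {v})`, whose square is `1`.
    have : eps w τ = -(eps v (insert v τ) * eps w (insert v τ) * eps v (insert v (τ.erase w))) := by
      linear_combination (-eps w τ) * e1 + eps v (insert v τ) * h3
    rw [this]
    linear_combination (-eps v (insert v τ) * eps w (insert v τ)) * e3

variable [Fintype V]

/-- The boundary of a function on the finite sets of vertices. -/
def bd (c : Finset V → M) (J : Finset V) : M :=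
  ∑ i ∈ Jᶜ, eps i (insert i J) • c (insert i J)

theorem bd_bd (c : Finset V → M) (J : Finset V) : bd (bd c) J = 0 := by
  simp only [bd, Finset.smul_sum, smul_smul]
  have hc : ∀ i, (insert i J)ᶜ = Jᶜ.erase i := fun i => Finset.compl_insert
  simp only [hc]
  refine sum_eq_zero_of_antisymm Jᶜ (fun i k => (eps i (insert i J) * eps k (insert k (insert i J)))
    • c (insert k (insert i J))) fun i hi k hk hik => ?_
  rw [Finset.mem_compl] at hi hk
  have h := eps_mul_eps_erase (v := i) (w := k) (τ := insert k (insert i J))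
    (by simp) (by simp) hik
  have h1 : (insert k (insert i J)).erase k = insert i J := Finset.erase_insert (by
    simp [hk, hik.symm])
  have h2 : (insert k (insert i J)).erase i = insert k J := by
    rw [Finset.insert_comm]
    exact Finset.erase_insert (by simp [hi, hik])
  rw [h1, h2] at h
  rw [Finset.insert_comm i k J, ← add_smul, mul_comm, mul_comm (eps k (insert k J)), h,
    add_neg_cancel, zero_smul]

/-- The contraction of the boundary by the vertex `v`. -/
def coneBd (v : V) (c : Finset V → M) (I : Finset V) : M :=
  if v ∈ I then eps v I • c (I.erase v) else 0

theorem bd_coneBd (v : V) (c : Finset V → M) (J : Finset V) :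
    bd (coneBd v c) J + coneBd v (bd c) J = c J := by
  by_cases hv : v ∈ J
  · have h1 : coneBd v (bd c) J = c J + ∑ i ∈ Jᶜ,
        (eps v J * eps i (insert i (J.erase v))) • c (insert i (J.erase v)) := by
      simp only [coneBd, hv, if_true, bd]
      rw [Finset.compl_erase, Finset.sum_insert (by simpa using hv), smul_add,
        Finset.insert_erase hv, eps_smul_eps_smul]
      simp only [Finset.smul_sum, smul_smul]
    rw [h1, add_left_comm, add_eq_left, bd, ← Finset.sum_add_distrib]
    refine Finset.sum_eq_zero fun i hi => ?_
    rw [Finset.mem_compl] at hi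
    have hvi : v ≠ i := fun h => hi (h ▸ hv)
    have h2 : (insert i J).erase v = insert i (J.erase v) := Finset.erase_insert_of_ne hvi.symm
    have h3 := eps_mul_eps_erase (Finset.mem_insert_of_mem hv) (Finset.mem_insert_self i J) hvi
    rw [Finset.erase_insert hi, h2] at h3
    simp only [coneBd, Finset.mem_insert_of_mem hv, if_true, smul_smul, h2]
    rw [← add_smul]
    convert zero_smul ℤ _
    have e1 := eps_mul_self v (insert i J)
    have e3 := eps_mul_self v J
    linear_combination (-(eps v J * eps i (insert i (J.erase v)))) * e1 +
      eps v J * eps v (insert i J) * h3 + (-(eps i (insert i J) * eps v (insert i J))) * e3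
  · have h1 : coneBd v (bd c) J = 0 := if_neg hv
    rw [h1, add_zero, bd, Finset.sum_eq_single_of_mem v (by simpa using hv)]
    · simp only [coneBd, Finset.mem_insert_self, if_true, Finset.erase_insert hv]
      exact eps_smul_eps_smul v _ _
    · intro i _ hiv
      rw [coneBd, if_neg, smul_zero]
      simp [hv, hiv.symm]

end Global

end
end MomentAngle

/-! ### Cohomology classes and `d'` through functions on all finite sets -/

namespace MomentAngle
noncomputable section
universe u
variable {V : Type}

/-- The empty set or a face of `K`. -/
def IsFace (K : PreAbstractSimplicialComplex V) (σ : Finset V) : Prop := σ = ∅ ∨ σ ∈ K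

theorem IsFace.mono {K L : PreAbstractSimplicialComplex V} (h : K ≤ L) {σ : Finset V}
    (hσ : IsFace K σ) : IsFace L σ :=
  hσ.imp_right fun hσ => h hσ

theorem IsFace.subset {K : PreAbstractSimplicialComplex V} {σ τ : Finset V} (hσ : IsFace K σ)
    (h : τ ⊆ σ) : IsFace K τ := by
  rcases τ.eq_empty_or_nonempty with h0 | h0
  · exact Or.inl h0
  · rcases hσ with rfl | hσ
    · exact Or.inl (Finset.subset_empty.1 h)
    · exact Or.inr ((K.isRelLowerSet_faces hσ).2 h h0)

theorem isFace_fullSubcomplex {K : PreAbstractSimplicialComplex V} {I σ : Finset V} :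
    IsFace (fullSubcomplex K I) σ ↔ IsFace K σ ∧ σ ⊆ I := by
  constructor
  · rintro (rfl | h)
    · exact ⟨Or.inl rfl, Finset.empty_subset _⟩
    · exact ⟨Or.inr h.1, h.2⟩
  · rintro ⟨rfl | h, h'⟩
    · exact Or.inl rfl
    · exact Or.inr ⟨h, h'⟩

theorem fullSubcomplex_le {K L : PreAbstractSimplicialComplex V} (h : K ≤ L) (I : Finset V) :
    fullSubcomplex K I ≤ fullSubcomplex L I :=
  fun _ hσ => ⟨h hσ.1, hσ.2⟩

variable [LinearOrder V]

theorem cobd_add {M : Type*} [AddCommGroup M] (f g : Finset V → M) (τ : Finset V) :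
    cobd (f + g) τ = cobd f τ + cobd g τ := by
  simp [cobd, Finset.sum_add_distrib]

theorem cobd_smul {R M : Type*} [Ring R] [AddCommGroup M] [Module R M] (a : R)
    (f : Finset V → M) (τ : Finset V) : cobd (a • f) τ = a • cobd f τ := by
  simp only [cobd, Finset.smul_sum, Pi.smul_apply]
  exact Finset.sum_congr rfl fun v _ => smul_comm _ _ _

variable (R : Type u) [CommRing R]

/-! ### Cohomology classes of functions on all finite sets of vertices -/

/-- The functions on all finite sets of vertices which restrict to `p`-cocycles of `K`. -/
def cocycles (K : PreAbstractSimplicialComplex V) (p : ℤ) : Submodule R (Finset V → R) where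
  carrier := {f | ∀ τ, IsFace K τ → (τ.card : ℤ) = p + 1 + 1 → cobd f τ = 0}
  zero_mem' := fun τ _ _ => cobd_eq_zero fun _ _ => rfl
  add_mem' := fun hf hg τ h h' => by rw [cobd_add, hf τ h h', hg τ h h', add_zero]
  smul_mem' := fun a f hf τ h h' => by rw [cobd_smul, hf τ h h', smul_zero]

variable {R} in
theorem cocycles_mono {K L : PreAbstractSimplicialComplex V} (h : K ≤ L) {p : ℤ}
    {f : Finset V → R} (hf : f ∈ cocycles R L p) : f ∈ cocycles R K p :=
  fun τ hτ hc => hf τ (hτ.mono h) hc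

/-- Restriction of a function to the `p`-simplices of `K`. -/
def toCochain (K : PreAbstractSimplicialComplex V) (p : ℤ) : (Finset V → R) →ₗ[R] Cochain R K p where
  toFun f σ := f σ.1
  map_add' _ _ := rfl
  map_smul' _ _ := rfl

theorem coboundary_toCochain (K : PreAbstractSimplicialComplex V) (p q : ℤ) (h : p + 1 = q)
    (f : Finset V → R) (τ : Simplex K q) :
    coboundary R K p q h (toCochain R K p f) τ = cobd f τ.1 :=
  Finset.sum_coe_sort τ.1 fun v => eps v τ.1 • f (τ.1.erase v)

theorem toCochain_surjective (K : PreAbstractSimplicialComplex V) (p : ℤ) :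
    Function.Surjective (toCochain R K p) := by
  classical
  intro f
  refine ⟨fun σ => if h : (σ = ∅ ∨ σ ∈ K) ∧ (σ.card : ℤ) = p + 1 then f ⟨σ, h⟩ else 0, ?_⟩
  funext σ
  exact dif_pos σ.2

/-- The cohomology class of a cocycle. -/
def cls (K : PreAbstractSimplicialComplex V) (p : ℤ) :
    cocycles R K p →ₗ[R] ReducedCohomology R K p :=
  (Submodule.mkQ ((LinearMap.range (coboundary R K (p - 1) p (sub_add_cancel p 1))).submoduleOf
    (LinearMap.ker (coboundary R K p (p + 1) rfl)))) ∘ₗ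
  ((toCochain R K p).restrict (p := cocycles R K p)
    (q := LinearMap.ker (coboundary R K p (p + 1) rfl)) (fun f hf => by
      rw [LinearMap.mem_ker]
      funext τ
      rw [coboundary_toCochain]
      exact hf τ.1 τ.2.1 τ.2.2))

theorem cls_surjective (K : PreAbstractSimplicialComplex V) (p : ℤ) :
    Function.Surjective (cls R K p) := by
  intro x
  obtain ⟨⟨y, hy⟩, rfl⟩ := Submodule.mkQ_surjective _ x
  obtain ⟨f, rfl⟩ := toCochain_surjective R K p y
  refine ⟨⟨f, fun τ h h' => ?_⟩, rfl⟩
  have := congrFun (LinearMap.mem_ker.1 hy) ⟨τ, h, h'⟩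
  rwa [coboundary_toCochain] at this

variable {R} in
/-- The function restricts to a `p`-coboundary of `K`. -/
def IsCobd (K : PreAbstractSimplicialComplex V) (p : ℤ) (f : Finset V → R) : Prop :=
  ∃ g : Finset V → R, ∀ σ, IsFace K σ → (σ.card : ℤ) = p + 1 → f σ = cobd g σ

variable {R} in
theorem cls_eq_zero_iff {K : PreAbstractSimplicialComplex V} {p : ℤ} (f : cocycles R K p) :
    cls R K p f = 0 ↔ IsCobd K p f.1 := by
  have : cls R K p f = 0 ↔ toCochain R K p f.1 ∈
      LinearMap.range (coboundary R K (p - 1) p (sub_add_cancel p 1)) :=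
    Submodule.Quotient.mk_eq_zero _
  rw [this]
  constructor
  · rintro ⟨y, hy⟩
    obtain ⟨g, rfl⟩ := toCochain_surjective R K (p - 1) y
    refine ⟨g, fun σ h h' => ?_⟩
    have := congrFun hy ⟨σ, h, h'⟩
    rw [coboundary_toCochain] at this
    exact this.symm
  · rintro ⟨g, hg⟩
    refine ⟨toCochain R K (p - 1) g, ?_⟩
    funext σ
    rw [coboundary_toCochain]
    exact (hg σ.1 σ.2.1 σ.2.2).symm

variable {R} in
theorem isCobd_of_forall {K : PreAbstractSimplicialComplex V} {p : ℤ} {f : Finset V → R}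
    (h : ∀ σ, IsFace K σ → (σ.card : ℤ) = p + 1 → f σ = 0) : IsCobd K p f :=
  ⟨0, fun σ h1 h2 => (h σ h1 h2).trans
    (cobd_eq_zero (f := (0 : Finset V → R)) fun _ _ => rfl).symm⟩

variable {R} in
theorem cls_eq_of_forall {K : PreAbstractSimplicialComplex V} {p : ℤ} {f g : cocycles R K p}
    (h : ∀ σ, IsFace K σ → (σ.card : ℤ) = p + 1 → f.1 σ = g.1 σ) : cls R K p f = cls R K p g := by
  rw [← sub_eq_zero, ← map_sub]
  exact (cls_eq_zero_iff _).2 (isCobd_of_forall fun σ h1 h2 => sub_eq_zero.2 (h σ h1 h2))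

variable {R} in
/-- A complex which is a cone with respect to its `p`-simplices has no cohomology in degree `p`. -/
theorem isCobd_of_cone {K : PreAbstractSimplicialComplex V} {p : ℤ} (v : V)
    (hv : ∀ σ, IsFace K σ → (σ.card : ℤ) = p + 1 → v ∉ σ → IsFace K (insert v σ))
    {f : Finset V → R} (hf : f ∈ cocycles R K p) : IsCobd K p f := by
  refine ⟨coneCobd v f, fun σ h1 h2 => ?_⟩
  rw [← cobd_coneCobd v f σ, add_eq_left, coneCobd]
  split_ifs with h
  · rfl
  · rw [hf _ (hv σ h1 h2 h), smul_zero]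
    rw [Finset.card_insert_of_notMem h]
    push_cast
    rw [h2]

/-- The evaluation of a cohomology class on the cycle `∂τ`, all facets of `τ` being faces of `K`:
the value at `τ` of the coboundary of a representative. -/
def evalBoundary (K : PreAbstractSimplicialComplex V) (p : ℤ) (τ : Finset V)
    (hc : (τ.card : ℤ) = p + 1 + 1) (hτ : ∀ v ∈ τ, IsFace K (τ.erase v)) :
    ReducedCohomology R K p →ₗ[R] R :=
  (LinearMap.ker (cls R K p)).liftQ
    { toFun := fun f => cobd f.1 τ
      map_add' := fun f g => cobd_add f.1 g.1 τ
      map_smul' := fun a f => cobd_smul a f.1 τ }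
    (fun f hf => by
      obtain ⟨g, hg⟩ := (cls_eq_zero_iff f).1 hf
      -- Well-definedness: every facet of `τ` is a face, so `f` may be replaced by `δg` on all of
      -- them, and `δδg` vanishes at `τ`.
      rw [LinearMap.mem_ker, LinearMap.coe_mk, AddHom.coe_mk, ← cobd_cobd g τ]
      refine cobd_congr fun v hv => hg _ (hτ v hv) ?_
      have := Finset.card_erase_add_one hv
      omega) ∘ₗ
  ((cls R K p).quotKerEquivOfSurjective (cls_surjective R K p)).symm.toLinearMap

@[simp]
theorem evalBoundary_cls (K : PreAbstractSimplicialComplex V) (p : ℤ) (τ : Finset V)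
    (hc : (τ.card : ℤ) = p + 1 + 1) (hτ : ∀ v ∈ τ, IsFace K (τ.erase v)) (f : cocycles R K p) :
    evalBoundary R K p τ hc hτ (cls R K p f) = cobd f.1 τ := by
  rw [evalBoundary, LinearMap.comp_apply]
  have : (cls R K p).quotKerEquivOfSurjective (cls_surjective R K p)
      (Submodule.Quotient.mk f) = cls R K p f := rfl
  rw [← this, LinearEquiv.coe_coe, LinearEquiv.symm_apply_apply]
  rfl

/-! ### Families of classes indexed by the full subcomplexes -/

/-- The families of cocycles of the full subcomplexes of `K`. -/
def cocycleFamilies (K : PreAbstractSimplicialComplex V) (p : ℤ) :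
    Submodule R (Finset V → Finset V → R) :=
  Submodule.pi Set.univ fun I => cocycles R (fullSubcomplex K I) p

variable {R} in
theorem cocycleFamilies_apply_mem {K : PreAbstractSimplicialComplex V} {p : ℤ}
    {F : Finset V → Finset V → R} (hF : F ∈ cocycleFamilies R K p) (I : Finset V) :
    F I ∈ cocycles R (fullSubcomplex K I) p :=
  hF I (Set.mem_univ I)

/-- The family of the cohomology classes of a family of cocycles. -/
def clsFamily (K : PreAbstractSimplicialComplex V) (p : ℤ) :
    cocycleFamilies R K p →ₗ[R] CH R K p where
  toFun F I := cls R (fullSubcomplex K I) p ⟨F.1 I, cocycleFamilies_apply_mem F.2 I⟩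
  map_add' F G := by
    funext I
    exact map_add (cls R (fullSubcomplex K I) p) ⟨F.1 I, cocycleFamilies_apply_mem F.2 I⟩
      ⟨G.1 I, cocycleFamilies_apply_mem G.2 I⟩
  map_smul' a F := by
    funext I
    exact map_smul (cls R (fullSubcomplex K I) p) a ⟨F.1 I, cocycleFamilies_apply_mem F.2 I⟩

theorem clsFamily_surjective (K : PreAbstractSimplicialComplex V) (p : ℤ) :
    Function.Surjective (clsFamily R K p) := by
  intro z
  choose F hF using fun I => cls_surjective R (fullSubcomplex K I) p (z I)
  exact ⟨⟨fun I => (F I).1, fun I _ => (F I).2⟩, funext hF⟩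

/-- The map `CH^p(L) → CH^p(K)` induced by an inclusion `K ⊆ L`. -/
def resCH {K L : PreAbstractSimplicialComplex V} (h : K ≤ L) (p : ℤ) : CH R L p →ₗ[R] CH R K p :=
  LinearMap.pi fun I => cohomologyRes R (fullSubcomplex_le h I) p ∘ₗ LinearMap.proj I

variable {R} in
theorem cocycleFamilies_mono {K L : PreAbstractSimplicialComplex V} (h : K ≤ L) {p : ℤ}
    {F : Finset V → Finset V → R} (hF : F ∈ cocycleFamilies R L p) :
    F ∈ cocycleFamilies R K p :=
  fun I _ => cocycles_mono (fullSubcomplex_le h I) (cocycleFamilies_apply_mem hF I)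

variable {R} in
theorem resCH_clsFamily {K L : PreAbstractSimplicialComplex V} (h : K ≤ L) (p : ℤ)
    (F : cocycleFamilies R L p) :
    resCH R h p (clsFamily R L p F) = clsFamily R K p ⟨F.1, cocycleFamilies_mono h F.2⟩ := rfl

variable [Fintype V]

theorem bd_apply {F : Finset V → Finset V → R} (J σ : Finset V) :
    bd F J σ = ∑ i ∈ Jᶜ, eps i (insert i J) • F (insert i J) σ := by
  simp [bd, Finset.sum_apply]

variable {R} in
theorem bd_mem_cocycleFamilies {K : PreAbstractSimplicialComplex V} {p : ℤ}
    {F : Finset V → Finset V → R} (hF : F ∈ cocycleFamilies R K p) :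
    bd F ∈ cocycleFamilies R K p := by
  intro J _
  refine Submodule.sum_mem _ fun i _ => zsmul_mem ?_ _
  exact cocycles_mono (fullSubcomplex_mono K (Finset.subset_insert i J))
    (cocycleFamilies_apply_mem hF _)

variable {R} in
-- Restriction to a smaller full subcomplex keeps the representing function, so on representatives
-- `d'` is the purely combinatorial boundary in the index `I`, up to the global sign.
theorem dPrime_clsFamily {K : PreAbstractSimplicialComplex V} {p : ℤ}
    (F : cocycleFamilies R K p) :
    dPrime R K p (clsFamily R K p F) =
      ((p + 1).negOnePow : ℤ) • clsFamily R K p ⟨bd F.1, bd_mem_cocycleFamilies F.2⟩ := by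
  funext J
  simp only [dPrime, LinearMap.pi_apply, LinearMap.smul_apply, LinearMap.sum_apply,
    LinearMap.comp_apply, LinearMap.proj_apply, Pi.smul_apply]
  congr 1
  have : ∀ i, cohomologyRes R (fullSubcomplex_mono K (Finset.subset_insert i J)) p
      (clsFamily R K p F (insert i J)) = cls R (fullSubcomplex K J) p ⟨F.1 (insert i J),
        cocycles_mono (fullSubcomplex_mono K (Finset.subset_insert i J))
          (cocycleFamilies_apply_mem F.2 _)⟩ := fun i => rfl
  simp only [this, ← map_zsmul, ← map_sum]
  change _ = cls R (fullSubcomplex K J) p _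
  congr 1
  ext σ
  simp [bd]

theorem dPrime_dPrime (K : PreAbstractSimplicialComplex V) (p : ℤ) (z : CH R K p) :
    dPrime R K p (dPrime R K p z) = 0 := by
  obtain ⟨F, rfl⟩ := clsFamily_surjective R K p z
  have : (⟨bd (bd F.1), bd_mem_cocycleFamilies (bd_mem_cocycleFamilies F.2)⟩ :
      cocycleFamilies R K p) = 0 := Subtype.ext (funext fun J => bd_bd F.1 J)
  rw [dPrime_clsFamily, map_zsmul, dPrime_clsFamily, this, map_zero, smul_zero, smul_zero]

theorem resCH_dPrime {K L : PreAbstractSimplicialComplex V} (h : K ≤ L) (p : ℤ) (z : CH R L p) :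
    resCH R h p (dPrime R L p z) = dPrime R K p (resCH R h p z) := by
  obtain ⟨F, rfl⟩ := clsFamily_surjective R L p z
  rw [dPrime_clsFamily, map_zsmul, resCH_clsFamily, resCH_clsFamily, dPrime_clsFamily]

end
end MomentAngle

namespace MomentAngle
noncomputable section
universe u

/-! ### Ranks of the homology of modules with a differential -/

section Rank

variable {R : Type u} [CommRing R] [IsDomain R] {M N : Type u} [AddCommGroup M] [Module R M]
  [AddCommGroup N] [Module R N]

omit [IsDomain R] in
theorem rank_submodule_lt (hM : Module.rank R M < ℵ₀) (P : Submodule R M) :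
    Module.rank R P < ℵ₀ := (Submodule.rank_le P).trans_lt hM

theorem finrank_range_add_finrank_ker_of_rank_lt (hM : Module.rank R M < ℵ₀) (f : M →ₗ[R] N) :
    Module.finrank R (LinearMap.range f) + Module.finrank R (LinearMap.ker f) =
      Module.finrank R M := by
  have h := f.rank_range_add_rank_ker
  have h1 : Module.rank R (LinearMap.range f) < ℵ₀ := (LinearMap.rank_le_domain f).trans_lt hM
  have h2 := rank_submodule_lt hM (LinearMap.ker f)
  unfold Module.finrank
  rw [← h, Cardinal.toNat_add h1 h2]

theorem finrank_map_add_finrank_inf_ker (hM : Module.rank R M < ℵ₀) (f : M →ₗ[R] N)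
    (P : Submodule R M) :
    Module.finrank R (P.map f) + Module.finrank R (P ⊓ LinearMap.ker f : Submodule R M) =
      Module.finrank R P := by
  rw [← finrank_range_add_finrank_ker_of_rank_lt (rank_submodule_lt hM P) (f.domRestrict P)]
  congr 1
  · rw [LinearMap.domRestrict, LinearMap.range_comp, Submodule.range_subtype]
  · have : LinearMap.ker (f.domRestrict P) = (P ⊓ LinearMap.ker f).submoduleOf P := by
      ext x
      simp [Submodule.submoduleOf]
    rw [this]
    exact (Submodule.submoduleOfEquivOfLe inf_le_left).finrank_eq.symm

/-- Over a domain rank is additive on exact sequences: `M` has rank `rank ker d + rank im d`, and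
`ker d` has rank `rank (ker d / im d) + rank im d`. Finiteness is required because `Module.finrank`
sends infinite ranks to zero. -/
theorem finrank_cohomologyAt (hM : Module.rank R M < ℵ₀) (d : M →ₗ[R] M)
    (hd : ∀ x, d (d x) = 0) :
    Module.finrank R (CohomologyAt d d) + 2 * Module.finrank R (LinearMap.range d) =
      Module.finrank R M := by
  have hle : LinearMap.range d ≤ LinearMap.ker d := by
    rintro _ ⟨x, rfl⟩
    exact hd x
  have h1 := finrank_range_add_finrank_ker_of_rank_lt hM d
  have h2 := finrank_range_add_finrank_ker_of_rank_lt (rank_submodule_lt hM (LinearMap.ker d))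
    (Submodule.mkQ ((LinearMap.range d).submoduleOf (LinearMap.ker d)))
  rw [Submodule.range_mkQ, finrank_top, Submodule.ker_mkQ,
    (Submodule.submoduleOfEquivOfLe hle).finrank_eq] at h2
  change Module.finrank R (CohomologyAt d d) + _ = _ at h2
  omega

omit [IsDomain R] in
theorem rank_cohomologyAt_lt (hM : Module.rank R M < ℵ₀) (d : M →ₗ[R] M) :
    Module.rank R (CohomologyAt d d) < ℵ₀ :=
  (rank_quotient_le _).trans_lt (rank_submodule_lt hM _)

omit [IsDomain R] in
theorem le_finrank_of_linearIndependent [Nontrivial R] (hM : Module.rank R M < ℵ₀) {k : ℕ}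
    {v : Fin k → M} (hv : LinearIndependent R v) : k ≤ Module.finrank R M := by
  have h := hv.cardinal_lift_le_rank
  rw [Cardinal.mk_fin, Cardinal.lift_natCast, ← Cardinal.cast_toNat_of_lt_aleph0 hM,
    Cardinal.lift_natCast, Nat.cast_le] at h
  exact h

theorem finrank_ideal_eq_one {I : Submodule R R} {a : R} (ha : a ∈ I) (h0 : a ≠ 0) :
    Module.finrank R I = 1 := by
  apply le_antisymm
  · have := Submodule.finrank_le I
    rwa [Module.finrank_self] at this
  · have hlt : Module.rank R I < ℵ₀ :=
      rank_submodule_lt (by rw [Module.rank_self]; exact Cardinal.one_lt_aleph0) I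
    refine le_finrank_of_linearIndependent hlt (v := fun _ : Fin 1 => (⟨a, ha⟩ : I)) ?_
    rw [Fintype.linearIndependent_iff]
    intro c hc i
    rw [Fin.sum_univ_one] at hc
    have h1 : c 0 * a = 0 := congrArg Subtype.val hc
    rw [Subsingleton.elim i 0]
    exact (mul_eq_zero.1 h1).resolve_right h0

/-- The image `φ(P)` is a nonzero ideal of a domain, hence of rank one. -/
theorem finrank_eq_finrank_inf_ker_add_one (hM : Module.rank R M < ℵ₀) (φ : M →ₗ[R] R)
    {P : Submodule R M} {x : M} (hx : x ∈ P) (h0 : φ x ≠ 0) :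
    Module.finrank R P = Module.finrank R (P ⊓ LinearMap.ker φ : Submodule R M) + 1 := by
  rw [← finrank_map_add_finrank_inf_ker hM φ P,
    finrank_ideal_eq_one (Submodule.mem_map_of_mem hx) h0, add_comm]

section Comparison

variable {dM : M →ₗ[R] M} {dN : N →ₗ[R] N} {g : M →ₗ[R] N}

theorem finrank_range_eq_of_surjective (hM : Module.rank R M < ℵ₀)
    (hg : Function.Surjective g) (hgd : ∀ x, g (dM x) = dN (g x)) :
    Module.finrank R (LinearMap.range dN) +
      Module.finrank R (LinearMap.range dM ⊓ LinearMap.ker g : Submodule R M) =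
      Module.finrank R (LinearMap.range dM) := by
  rw [← finrank_map_add_finrank_inf_ker hM g (LinearMap.range dM), ← LinearMap.range_comp]
  have : g ∘ₗ dM = dN ∘ₗ g := LinearMap.ext hgd
  rw [this, LinearMap.range_comp_of_range_eq_top _ (LinearMap.range_eq_top.2 hg)]

variable (hM : Module.rank R M < ℵ₀) (hN : Module.rank R N < ℵ₀) (hdM : ∀ x, dM (dM x) = 0)
  (hdN : ∀ x, dN (dN x) = 0) (hg : Function.Surjective g) (hgd : ∀ x, g (dM x) = dN (g x))
  (φ : M →ₗ[R] R) {e : M} (he : g e = 0) (hde : dM e = 0) (hφe : φ e ≠ 0)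
  (hφd : ∀ x, g x = 0 → φ (dM x) = 0)
  (hex : ∀ y, g y = 0 → dM y = 0 → φ y = 0 → ∃ x, g x = 0 ∧ dM x = y)

include hM hN hdM hdN hg hgd in
-- A rank count that replaces the long exact sequence. All that remains unknown is how much of `ker
-- g` consists of boundaries of the whole source.
theorem finrank_cohomologyAt_of_surjective :
    Module.finrank R (CohomologyAt dM dM) +
      2 * Module.finrank R (LinearMap.range dM ⊓ LinearMap.ker g : Submodule R M) =
    Module.finrank R (CohomologyAt dN dN) + Module.finrank R (LinearMap.ker g) := by
  have h1 := finrank_cohomologyAt hM dM hdM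
  have h2 := finrank_cohomologyAt hN dN hdN
  have h3 := finrank_range_add_finrank_ker_of_rank_lt hM g
  rw [LinearMap.range_eq_top.2 hg, finrank_top] at h3
  have h4 := finrank_range_eq_of_surjective hM hg hgd
  omega

include hgd hφd hex in
omit [IsDomain R] in
theorem ker_inf_ker_inf_ker_eq_map (hdM : ∀ x, dM (dM x) = 0) :
    LinearMap.ker g ⊓ LinearMap.ker dM ⊓ LinearMap.ker φ = (LinearMap.ker g).map dM := by
  ext y
  simp only [Submodule.mem_inf, LinearMap.mem_ker, Submodule.mem_map]
  constructor
  · rintro ⟨⟨h1, h2⟩, h3⟩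
    exact hex y h1 h2 h3
  · rintro ⟨x, hx, rfl⟩
    exact ⟨⟨by rw [hgd, hx, map_zero], hdM x⟩, hφd x hx⟩

include hM hdM hgd he hde hφe hφd hex

theorem finrank_ker_eq :
    Module.finrank R (LinearMap.ker g) =
      2 * Module.finrank R ((LinearMap.ker g).map dM) + 1 := by
  have h1 := finrank_map_add_finrank_inf_ker hM dM (LinearMap.ker g)
  have h2 := finrank_eq_finrank_inf_ker_add_one hM φ
    (P := LinearMap.ker g ⊓ LinearMap.ker dM) (x := e) ⟨he, hde⟩ hφe
  rw [ker_inf_ker_inf_ker_eq_map hgd φ hφd hex hdM] at h2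
  omega

include hN hdN hg

/-- Let the kernel of a surjection of complexes have homology of rank one. If no multiple of its
generator becomes a boundary, the homology of the source has rank one more than that of the
target. -/
theorem finrank_cohomologyAt_eq_add_one (h : ∀ x, g (dM x) = 0 → φ (dM x) = 0) :
    Module.finrank R (CohomologyAt dM dM) = Module.finrank R (CohomologyAt dN dN) + 1 := by
  have h1 := finrank_cohomologyAt_of_surjective hM hN hdM hdN hg hgd
  have h2 := finrank_ker_eq hM hdM hgd φ he hde hφe hφd hex
  -- Since `φ` kills every boundary lying in `ker g`, such a boundary already bounds inside `ker g`.
  have h3 : LinearMap.range dM ⊓ LinearMap.ker g = (LinearMap.ker g).map dM := by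
    rw [← ker_inf_ker_inf_ker_eq_map hgd φ hφd hex hdM]
    ext y
    simp only [Submodule.mem_inf, LinearMap.mem_ker, LinearMap.mem_range]
    constructor
    · rintro ⟨⟨x, rfl⟩, hy⟩
      exact ⟨⟨hy, hdM x⟩, h x hy⟩
    · rintro ⟨⟨h1, h2⟩, h3⟩
      obtain ⟨x, _, hx⟩ := hex y h1 h2 h3
      exact ⟨⟨x, hx⟩, h1⟩
  rw [h3] at h1
  omega

/-- Let the kernel of a surjection of complexes have homology of rank one. If a multiple of its
generator becomes a boundary, the homology of the source has rank one less than that of the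
target. -/
theorem finrank_cohomologyAt_add_one_eq (h : ∃ x, g (dM x) = 0 ∧ φ (dM x) ≠ 0) :
    Module.finrank R (CohomologyAt dM dM) + 1 = Module.finrank R (CohomologyAt dN dN) := by
  have h1 := finrank_cohomologyAt_of_surjective hM hN hdM hdN hg hgd
  have h2 := finrank_ker_eq hM hdM hgd φ he hde hφe hφd hex
  obtain ⟨x, hx, hφx⟩ := h
  have h4 := finrank_eq_finrank_inf_ker_add_one hM φ
    (P := LinearMap.range dM ⊓ LinearMap.ker g) (x := dM x) ⟨⟨x, rfl⟩, hx⟩ hφx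
  -- Boundaries in `ker g` now exceed those coming from `ker g` by rank one, the part seen by `φ`.
  have h3 : LinearMap.range dM ⊓ LinearMap.ker g ⊓ LinearMap.ker φ = (LinearMap.ker g).map dM := by
    rw [← ker_inf_ker_inf_ker_eq_map hgd φ hφd hex hdM]
    ext y
    simp only [Submodule.mem_inf, LinearMap.mem_ker, LinearMap.mem_range]
    constructor
    · rintro ⟨⟨⟨x, rfl⟩, hy⟩, hy'⟩
      exact ⟨⟨hy, hdM x⟩, hy'⟩
    · rintro ⟨⟨h1, h2⟩, h3⟩
      obtain ⟨x, _, hx⟩ := hex y h1 h2 h3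
      exact ⟨⟨⟨x, hx⟩, h1⟩, h3⟩
  rw [h3] at h4
  omega

omit hM hN hdM hdN hg hgd he hde hφe hφd hex in
/-- Adding to a complex, along an injection, a cycle lying outside of it raises the rank of the
homology by one. -/
theorem finrank_cohomologyAt_add_one_eq_of_injective (hM : Module.rank R M < ℵ₀)
    (hN : Module.rank R N < ℵ₀) (hdM : ∀ x, dM (dM x) = 0)
    (hdN : ∀ x, dN (dN x) = 0) (hg : Function.Injective g) (hgd : ∀ x, g (dM x) = dN (g x))
    (φ : N →ₗ[R] R) (hφ : LinearMap.ker φ = LinearMap.range g) {e : N} (he : IsUnit (φ e))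
    (hde : dN e = 0) :
    Module.finrank R (CohomologyAt dM dM) + 1 = Module.finrank R (CohomologyAt dN dN) := by
  have h1 := finrank_cohomologyAt hM dM hdM
  have h2 := finrank_cohomologyAt hN dN hdN
  have h3 := finrank_eq_finrank_inf_ker_add_one hN φ (P := ⊤) (x := e) trivial he.ne_zero
  rw [top_inf_eq, hφ, finrank_top, LinearMap.finrank_range_of_inj hg] at h3
  -- Subtracting a multiple of the cycle `e` moves any element into the range of `g` without
  -- changing its differential. This division is why `φ e` must be a unit.
  have h4 : LinearMap.range dN = (LinearMap.range dM).map g := by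
    ext y
    simp only [Submodule.mem_map, LinearMap.mem_range, exists_exists_eq_and]
    constructor
    · rintro ⟨z, rfl⟩
      obtain ⟨u, hu⟩ := he
      have : z - (φ z * ↑u⁻¹) • e ∈ LinearMap.ker φ := by
        rw [LinearMap.mem_ker, map_sub, map_smul, ← hu, smul_eq_mul, mul_assoc, Units.inv_mul,
          mul_one, sub_self]
      rw [hφ] at this
      obtain ⟨x, hx⟩ := this
      exact ⟨x, by rw [hgd, hx, map_sub, map_smul, hde, smul_zero, sub_zero]⟩
    · rintro ⟨x, rfl⟩
      exact ⟨g x, (hgd x).symm⟩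
  have h5 : Module.finrank R ((LinearMap.range dM).map g) =
      Module.finrank R (LinearMap.range dM) :=
    (Submodule.equivMapOfInjective g hg _).finrank_eq.symm
  rw [← h4] at h5
  omega

omit hM hN hdM hdN hg hgd he hde hφe hφd hex in
theorem finrank_cohomologyAt_eq_of_bijective (hM : Module.rank R M < ℵ₀)
    (hN : Module.rank R N < ℵ₀) (hdM : ∀ x, dM (dM x) = 0)
    (hdN : ∀ x, dN (dN x) = 0) (hg : Function.Bijective g) (hgd : ∀ x, g (dM x) = dN (g x)) :
    Module.finrank R (CohomologyAt dM dM) = Module.finrank R (CohomologyAt dN dN) := by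
  have h1 := finrank_cohomologyAt_of_surjective hM hN hdM hdN hg.2 hgd
  rw [LinearMap.ker_eq_bot.2 hg.1, inf_bot_eq, finrank_bot] at h1
  omega

end Comparison

/-- The rank of a direct sum almost all of whose summands are zero. -/
theorem finrank_directSum_eq_sum {ι : Type} [DecidableEq ι] (A : ι → Type u)
    [∀ i, AddCommGroup (A i)] [∀ i, Module R (A i)] (hA : ∀ i, Module.rank R (A i) < ℵ₀)
    (S : Finset ι) (hS : ∀ i ∉ S, Subsingleton (A i)) :
    Module.finrank R (⨁ i, A i) = ∑ i ∈ S, Module.finrank R (A i) := by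
  -- The elements supported on `T`; their rank is found by induction on `T`, projecting to one new
  -- component at a time.
  let N : Finset ι → Submodule R (⨁ i, A i) := fun T =>
    ⨅ (i : ι) (_ : i ∉ T), LinearMap.ker (DirectSum.component R ι A i)
  have mem_N : ∀ T (x : ⨁ i, A i), x ∈ N T ↔ ∀ i ∉ T, x i = 0 := fun T x => by
    simp only [N, Submodule.mem_iInf]
    rfl
  have key : ∀ T : Finset ι, Module.rank R (N T) = ∑ i ∈ T, Module.rank R (A i) := by
    intro T
    induction T using Finset.induction_on with
    | empty =>
      have : N ∅ = ⊥ := by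
        rw [eq_bot_iff]
        intro x hx
        exact DFinsupp.ext fun i => (mem_N ∅ x).1 hx i (Finset.notMem_empty i)
      rw [this, rank_bot, Finset.sum_empty]
    | insert a T ha ih =>
      let f := (DirectSum.component R ι A a).domRestrict (N (insert a T))
      have hf : LinearMap.range f = ⊤ := by
        rw [LinearMap.range_eq_top]
        intro y
        refine ⟨⟨DirectSum.lof R ι A a y, (mem_N _ _).2 fun i hi => ?_⟩, ?_⟩
        · exact DFinsupp.single_eq_of_ne fun h => hi (h ▸ Finset.mem_insert_self _ _)
        · exact DirectSum.component.lof_self R a y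
      have hk : LinearMap.ker f = (N T).submoduleOf (N (insert a T)) := by
        ext ⟨x, hx⟩
        rw [mem_N] at hx
        simp only [Submodule.submoduleOf, Submodule.mem_comap, Submodule.subtype_apply, mem_N]
        change x a = 0 ↔ _
        constructor
        · intro h i hi
          by_cases hia : i = a
          · rw [hia, h]
          · exact hx i (by simp [hia, hi])
        · intro h
          exact h a ha
      have hle : N T ≤ N (insert a T) := fun x hx =>
        (mem_N _ _).2 fun i hi => (mem_N T x).1 hx i fun h => hi (Finset.mem_insert_of_mem h)
      rw [← f.rank_range_add_rank_ker, hf, rank_top, hk,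
        (Submodule.submoduleOfEquivOfLe hle).rank_eq, ih, Finset.sum_insert ha]
  have htop : N S = ⊤ := by
    rw [eq_top_iff]
    intro x _
    exact (mem_N S x).2 fun i hi => (hS i hi).elim _ _
  have h := key S
  rw [htop, rank_top] at h
  unfold Module.finrank
  have h' : ∑ i ∈ S, Module.rank R (A i) =
      ((∑ i ∈ S, Cardinal.toNat (Module.rank R (A i)) : ℕ) : Cardinal) := by
    rw [Nat.cast_sum]
    exact Finset.sum_congr rfl fun i _ => (Cardinal.cast_toNat_of_lt_aleph0 (hA i)).symm
  rw [h, h', Cardinal.toNat_natCast]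

end Rank
end
end MomentAngle

/-! ### Families supported at one index, and finiteness -/

namespace MomentAngle
noncomputable section
universe u
variable {V : Type} [LinearOrder V]

theorem cobd_single_eq_zero {M : Type*} [AddCommGroup M] {σ τ : Finset V} (a : M)
    (h : ∀ v ∈ τ, τ.erase v ≠ σ) : cobd (Pi.single σ a) τ = 0 :=
  cobd_eq_zero fun v hv => Pi.single_eq_of_ne (M := fun _ => M) (h v hv) a

theorem cobd_single {M : Type*} [AddCommGroup M] {τ : Finset V} {v : V} (hv : v ∈ τ) (a : M) :
    cobd (Pi.single (τ.erase v) a) τ = eps v τ • a := by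
  rw [cobd_eq_single hv, Pi.single_eq_same]
  intro w _ hwv
  refine Pi.single_eq_of_ne (M := fun _ => M) (fun h => ?_) a
  have h1 : v ∈ τ.erase w := Finset.mem_erase.2 ⟨hwv.symm, hv⟩
  rw [h] at h1
  exact Finset.notMem_erase v τ h1

theorem bd_single_erase {M : Type*} [AddCommGroup M] [Fintype V] {I : Finset V} {i : V}
    (hi : i ∈ I) (a : M) : bd (Pi.single I a) (I.erase i) = eps i I • a := by
  rw [bd, Finset.sum_eq_single_of_mem i (by simp), Finset.insert_erase hi, Pi.single_eq_same]
  intro k hk hki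
  rw [Pi.single_eq_of_ne, smul_zero]
  intro h
  have h1 : i ∈ insert k (I.erase i) := by rw [h]; exact hi
  rcases Finset.mem_insert.1 h1 with h2 | h2
  · exact hki h2.symm
  · exact Finset.notMem_erase i I h2

theorem bd_single_eq_zero {M : Type*} [AddCommGroup M] [Fintype V] {I J : Finset V} (a : M)
    (h : ∀ i ∈ I, J ≠ I.erase i) : bd (Pi.single I a) J = 0 := by
  refine Finset.sum_eq_zero fun i hi => ?_
  rw [Pi.single_eq_of_ne, smul_zero]
  rintro rfl
  refine h i (Finset.mem_insert_self i J) ?_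
  rw [Finset.erase_insert (Finset.mem_compl.1 hi)]

variable {R : Type u} [CommRing R]

theorem single_mem_cocycleFamilies {K : PreAbstractSimplicialComplex V} {p : ℤ} {I : Finset V}
    {f : Finset V → R} (hf : f ∈ cocycles R (fullSubcomplex K I) p) :
    Pi.single I f ∈ cocycleFamilies R K p := by
  intro J _
  rcases eq_or_ne J I with rfl | h
  · rwa [Pi.single_eq_same]
  · rw [Pi.single_eq_of_ne h]
    exact zero_mem _

theorem clsFamily_eq_zero_iff {K : PreAbstractSimplicialComplex V} {p : ℤ}
    (F : cocycleFamilies R K p) :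
    clsFamily R K p F = 0 ↔ ∀ I, IsCobd (fullSubcomplex K I) p (F.1 I) := by
  rw [funext_iff]
  exact forall_congr' fun I => cls_eq_zero_iff ⟨F.1 I, cocycleFamilies_apply_mem F.2 I⟩

@[simp]
theorem evalBoundary_clsFamily {K : PreAbstractSimplicialComplex V} {p : ℤ} {I τ : Finset V}
    (hc : (τ.card : ℤ) = p + 1 + 1) (hτ : ∀ v ∈ τ, IsFace (fullSubcomplex K I) (τ.erase v))
    (F : cocycleFamilies R K p) :
    evalBoundary R (fullSubcomplex K I) p τ hc hτ (clsFamily R K p F I) = cobd (F.1 I) τ :=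
  evalBoundary_cls R (fullSubcomplex K I) p τ hc hτ ⟨F.1 I, cocycleFamilies_apply_mem F.2 I⟩

theorem clsFamily_eq_of_forall {K : PreAbstractSimplicialComplex V} {p : ℤ}
    {F G : cocycleFamilies R K p} (h : ∀ I σ, IsFace K σ → σ ⊆ I → (σ.card : ℤ) = p + 1 →
      F.1 I σ = G.1 I σ) : clsFamily R K p F = clsFamily R K p G :=
  funext fun I => cls_eq_of_forall fun σ h1 h2 =>
    h I σ (isFace_fullSubcomplex.1 h1).1 (isFace_fullSubcomplex.1 h1).2 h2

theorem IsCobd.zsmul {K : PreAbstractSimplicialComplex V} {p : ℤ} {f : Finset V → R}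
    (h : IsCobd K p f) (a : ℤ) : IsCobd K p (a • f) := by
  obtain ⟨g, hg⟩ := h
  refine ⟨a • g, fun σ h1 h2 => ?_⟩
  rw [cobd_smul, Pi.smul_apply, hg σ h1 h2]

variable [Fintype V]

theorem dPrime_single_eq_zero {K : PreAbstractSimplicialComplex V} {p : ℤ} {I : Finset V}
    {f : Finset V → R} (hf : f ∈ cocycles R (fullSubcomplex K I) p)
    (h : ∀ i ∈ I, IsCobd (fullSubcomplex K (I.erase i)) p f) :
    dPrime R K p (clsFamily R K p ⟨Pi.single I f, single_mem_cocycleFamilies hf⟩) = 0 := by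
  rw [dPrime_clsFamily, (clsFamily_eq_zero_iff _).2, smul_zero]
  intro J
  by_cases hJ : ∃ i ∈ I, J = I.erase i
  · obtain ⟨i, hi, rfl⟩ := hJ
    change IsCobd _ p (bd (Pi.single I f) (I.erase i))
    rw [bd_single_erase hi]
    exact (h i hi).zsmul _
  · push Not at hJ
    change IsCobd _ p (bd (Pi.single I f) J)
    rw [bd_single_eq_zero f hJ]
    exact isCobd_of_forall fun _ _ _ => rfl

theorem rank_CH_lt [Nontrivial R] (K : PreAbstractSimplicialComplex V) (p : ℤ) :
    Module.rank R (CH R K p) < ℵ₀ :=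
  (LinearMap.rank_le_of_surjective _ (clsFamily_surjective R K p)).trans_lt
    ((Submodule.rank_le _).trans_lt (Module.rank_lt_aleph0 R (Finset V → Finset V → R)))

theorem rank_reducedCohomology_lt [Nontrivial R] (K : PreAbstractSimplicialComplex V) (p : ℤ) :
    Module.rank R (ReducedCohomology R K p) < ℵ₀ :=
  (LinearMap.rank_le_of_surjective _ (cls_surjective R K p)).trans_lt
    ((Submodule.rank_le _).trans_lt (Module.rank_lt_aleph0 R (Finset V → R)))

theorem subsingleton_HHDeg {K : PreAbstractSimplicialComplex V} {p : ℤ}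
    (h : p < -1 ∨ (Fintype.card V : ℤ) ≤ p) : Subsingleton (HHDeg R K p) := by
  have : Subsingleton (CH R K p) := by
    refine subsingleton_of_forall_eq 0 fun z => ?_
    obtain ⟨F, rfl⟩ := clsFamily_surjective R K p z
    refine (clsFamily_eq_zero_iff F).2 fun I => isCobd_of_forall fun σ _ h2 => ?_
    have := σ.card_le_univ
    omega
  infer_instance

/-- `L` is obtained from `K` by gluing an `n`-simplex `s` along its boundary, and `K` contains the
cones over this boundary with any apex outside of `s`. -/
structure IsGluing (K L : PreAbstractSimplicialComplex V) (s : Finset V) (n : ℕ) : Prop where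
  le : K ≤ L
  isFace_iff : ∀ σ, IsFace L σ ↔ IsFace K σ ∨ σ = s
  not_isFace : ¬ IsFace K s
  card_eq : s.card = n + 1
  pos : 1 ≤ n
  isFace_erase : ∀ j ∉ s, ∀ i ∈ s, IsFace K ((insert j s).erase i)

/-! ### Restriction from the glued complex to `K` -/

namespace IsGluing

variable {K L : PreAbstractSimplicialComplex V} {s : Finset V} {n : ℕ} (h : IsGluing K L s n)
include h

omit [Fintype V] in
theorem exists_ne (a : V) : ∃ b ∈ s, b ≠ a :=
  Finset.exists_mem_ne (by have := h.card_eq; have := h.pos; omega) a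

omit [Fintype V] in
theorem isFace_of_card_ne {σ : Finset V} (hσ : IsFace L σ) (hc : σ.card ≠ n + 1) : IsFace K σ :=
  ((h.isFace_iff σ).1 hσ).resolve_right fun h' => hc (h' ▸ h.card_eq)

omit [Fintype V] in
theorem not_subset_of_isFace {σ : Finset V} (hσ : IsFace K σ) : ¬ s ⊆ σ :=
  fun hs => h.not_isFace (hσ.subset hs)

omit [Fintype V] in
-- Being a `p`-coboundary is tested on `p`-simplices only, and these change only for `p = n`.
theorem resCH_injective {p : ℤ} (hp : p ≠ n) : Function.Injective (resCH R h.le p) := by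
  rw [injective_iff_map_eq_zero]
  intro z hz
  obtain ⟨F, rfl⟩ := clsFamily_surjective R L p z
  rw [resCH_clsFamily, clsFamily_eq_zero_iff] at hz
  refine (clsFamily_eq_zero_iff F).2 fun I => ?_
  obtain ⟨g, hg⟩ := hz I
  refine ⟨g, fun σ h1 h2 => hg σ ?_ h2⟩
  rw [isFace_fullSubcomplex] at h1 ⊢
  exact ⟨h.isFace_of_card_ne h1.1 (by omega), h1.2⟩

omit [Fintype V] in
-- Being a `p`-cocycle is tested on `(p + 1)`-simplices only, and these change only for `p = n - 1`.
theorem resCH_surjective {p : ℤ} (hp : p ≠ n - 1) : Function.Surjective (resCH R h.le p) := by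
  intro z
  obtain ⟨F, rfl⟩ := clsFamily_surjective R K p z
  refine ⟨clsFamily R L p ⟨F.1, fun I _ τ h1 h2 => ?_⟩, rfl⟩
  rw [isFace_fullSubcomplex] at h1
  exact cocycleFamilies_apply_mem F.2 I τ
    (isFace_fullSubcomplex.2 ⟨h.isFace_of_card_ne h1.1 (by omega), h1.2⟩) h2

theorem finrank_HHDeg_eq [IsDomain R] {p : ℤ} (h1 : p ≠ n) (h2 : p ≠ n - 1) :
    Module.finrank R (HHDeg R L p) = Module.finrank R (HHDeg R K p) :=
  finrank_cohomologyAt_eq_of_bijective (rank_CH_lt L p) (rank_CH_lt K p) (dPrime_dPrime R L p)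
    (dPrime_dPrime R K p) ⟨h.resCH_injective h1, h.resCH_surjective h2⟩ (resCH_dPrime R h.le p)

/-! ### The degree below the dimension of the glued simplex -/

omit [Fintype V] in
theorem isFace_of_ssubset (hs : ∃ j, j ∉ s) {σ : Finset V} (hσ : σ ⊂ s) : IsFace K σ := by
  obtain ⟨j, hj⟩ := hs
  obtain ⟨i, hi, hσi⟩ := Finset.exists_of_ssubset hσ
  refine (h.isFace_erase j hj i hi).subset fun x hx => ?_
  rw [Finset.mem_erase]
  exact ⟨fun hxi => hσi (hxi ▸ hx), Finset.mem_insert_of_mem (hσ.1 hx)⟩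

/-- The only new condition on cocycles is that `δf` vanish at `s`. It has content only in the
summand `I = s`, where it is evaluation on `∂s`. The extra cycle `e` is the dual cochain of one
facet of `s`. -/
theorem finrank_HHDeg_pred [IsDomain R] (hs : ∃ j, j ∉ s) :
    Module.finrank R (HHDeg R L (n - 1)) + 1 = Module.finrank R (HHDeg R K (n - 1)) := by
  have hc := h.card_eq
  obtain ⟨a, ha, -⟩ := h.exists_ne (hs.choose)
  have hface : ∀ v ∈ s, IsFace (fullSubcomplex K s) (s.erase v) := fun v hv =>
    isFace_fullSubcomplex.2 ⟨h.isFace_of_ssubset hs (Finset.erase_ssubset hv),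
      Finset.erase_subset _ _⟩
  have hf : (Pi.single (s.erase a) 1 : Finset V → R) ∈
      cocycles R (fullSubcomplex K s) (n - 1) := by
    intro τ h1 h2
    rw [isFace_fullSubcomplex] at h1
    refine absurd h1.1 ?_
    rw [Finset.eq_of_subset_of_card_le h1.2 (by omega)]
    exact h.not_isFace
  refine finrank_cohomologyAt_add_one_eq_of_injective (rank_CH_lt L _) (rank_CH_lt K _)
    (dPrime_dPrime R L _) (dPrime_dPrime R K _) (h.resCH_injective (by omega))
    (resCH_dPrime R h.le _)
    (evalBoundary R (fullSubcomplex K s) (n - 1) s (by omega) hface ∘ₗ LinearMap.proj s) ?_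
    (e := clsFamily R K _ ⟨Pi.single s (Pi.single (s.erase a) 1), single_mem_cocycleFamilies hf⟩)
    ?_ (dPrime_single_eq_zero hf fun i hi => ?_)
  · ext z
    obtain ⟨F, rfl⟩ := clsFamily_surjective R K _ z
    rw [LinearMap.mem_ker, LinearMap.comp_apply, LinearMap.proj_apply, evalBoundary_clsFamily,
      LinearMap.mem_range]
    constructor
    · intro hz
      refine ⟨clsFamily R L _ ⟨F.1, fun I _ τ h1 h2 => ?_⟩, rfl⟩
      rw [isFace_fullSubcomplex, h.isFace_iff] at h1
      have hFI := cocycleFamilies_apply_mem F.2 I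
      rcases h1 with ⟨h1 | rfl, h3⟩
      · exact hFI τ (isFace_fullSubcomplex.2 ⟨h1, h3⟩) h2
      · rcases h3.eq_or_ssubset with rfl | h4
        · exact hz
        · obtain ⟨j, hj, hjs⟩ := Finset.exists_of_ssubset h4
          -- For `I ⊋ s` the condition is automatic: `δδf` at `s ∪ {j}` reduces to `± δf` at `s`, as
          -- the other facets of `s ∪ {j}` lie in `K`.
          have h5 := cobd_cobd (F.1 I) (insert j τ)
          rw [cobd_eq_single (Finset.mem_insert_self j τ), Finset.erase_insert hjs] at h5
          · exact eps_smul_eq_zero h5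
          · intro w hw hwj
            have hw' : w ∈ τ := Finset.mem_of_mem_insert_of_ne hw hwj
            refine hFI _ (isFace_fullSubcomplex.2 ⟨h.isFace_erase j hjs w hw', ?_⟩) ?_
            · exact (Finset.erase_subset _ _).trans (Finset.insert_subset hj h3)
            · have := Finset.card_erase_add_one hw
              rw [Finset.card_insert_of_notMem hjs] at this
              omega
    · rintro ⟨x, hx⟩
      obtain ⟨G, rfl⟩ := clsFamily_surjective R L _ x
      rw [resCH_clsFamily] at hx
      have h1 := congrArg (evalBoundary R (fullSubcomplex K s) (n - 1) s (by omega) hface)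
        (congrFun hx s)
      rw [evalBoundary_clsFamily, evalBoundary_clsFamily] at h1
      rw [← h1]
      exact cocycleFamilies_apply_mem G.2 s s (isFace_fullSubcomplex.2
        ⟨(h.isFace_iff s).2 (Or.inr rfl), subset_rfl⟩) (by omega)
  · rw [LinearMap.comp_apply, LinearMap.proj_apply, evalBoundary_clsFamily]
    dsimp only
    rw [Pi.single_eq_same, cobd_single ha]
    refine IsUnit.of_mul_eq_one (eps a s • (1 : R)) ?_
    rw [smul_mul_smul_comm, eps_mul_self, one_smul, mul_one]
  -- The restriction of `e` to `s \ {i}` is null: for `i = a` this complex is a full simplex, and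
  -- for `i ≠ a` it does not contain the chosen facet.
  · rcases eq_or_ne i a with rfl | hia
    · obtain ⟨b, hb, hbi⟩ := h.exists_ne i
      refine isCobd_of_cone b (fun σ h1 h2 hbσ => ?_)
        (cocycles_mono (fullSubcomplex_mono K (Finset.erase_subset _ _)) hf)
      rw [isFace_fullSubcomplex] at h1
      have h3 := Finset.card_erase_add_one hi
      rw [Finset.eq_of_subset_of_card_le h1.2 (by omega)] at hbσ
      exact absurd (Finset.mem_erase.2 ⟨hbi, hb⟩) hbσ
    · refine isCobd_of_forall fun σ h1 _ => Pi.single_eq_of_ne ?_ _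
      rintro rfl
      exact Finset.notMem_erase i s ((isFace_fullSubcomplex.1 h1).2
        (Finset.mem_erase.2 ⟨hia, hi⟩))

end IsGluing
end
end MomentAngle

namespace MomentAngle
noncomputable section
universe u
theorem negOnePow_smul_negOnePow_smul {M : Type*} [AddCommGroup M] (p : ℤ) (x : M) :
    (p.negOnePow : ℤ) • (p.negOnePow : ℤ) • x = x := by
  rw [smul_smul, ← Units.val_mul, Int.units_mul_self, Units.val_one, one_smul]

variable {V : Type} [LinearOrder V] {R : Type u} [CommRing R]

/-! ### The degree of the dimension of the glued simplex -/

/-- The family of functions whose member at `I` is `c I` at `s` and zero elsewhere. -/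
def dualFamily (s : Finset V) (c : Finset V → R) : Finset V → Finset V → R :=
  fun I => Pi.single s (c I)

theorem bd_dualFamily [Fintype V] (s : Finset V) (c : Finset V → R) :
    bd (dualFamily s c) = dualFamily s (bd c) := by
  funext J σ
  rw [bd_apply, dualFamily, Pi.single_apply]
  split_ifs with hσ
  · subst hσ
    exact Finset.sum_congr rfl fun i _ => by rw [dualFamily, Pi.single_eq_same]
  · refine Finset.sum_eq_zero fun i _ => ?_
    rw [dualFamily, Pi.single_eq_of_ne hσ, smul_zero]

namespace IsGluing

variable {K L : PreAbstractSimplicialComplex V} {s : Finset V} {n : ℕ} (h : IsGluing K L s n)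
include h

/-- No simplex of dimension `n + 1` in `L` contains `s`, since it would lie in `K` and force `s ∈
K`. -/
theorem dualFamily_mem (c : Finset V → R) : dualFamily s c ∈ cocycleFamilies R L n := by
  intro I _ τ h1 h2
  rw [isFace_fullSubcomplex] at h1
  refine cobd_single_eq_zero _ fun v _ hv => ?_
  exact h.not_subset_of_isFace (h.isFace_of_card_ne h1.1 (by omega))
    (hv ▸ Finset.erase_subset v τ)

theorem isCobd_dualFamily (c : Finset V → R) (hc : ∀ I, s ⊂ I → c I = 0) (I : Finset V) :
    IsCobd (fullSubcomplex L I) n (dualFamily s c I) := by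
  have hs := h.card_eq
  by_cases hI : s ⊂ I
  · rw [dualFamily, hc I hI, Pi.single_zero]
    exact isCobd_of_forall fun _ _ _ => rfl
  by_cases hI' : s = I
  · subst hI'
    obtain ⟨b, hb⟩ : s.Nonempty := Finset.card_pos.1 (by omega)
    refine isCobd_of_cone b (fun σ h1 h2 hbσ => ?_)
      (cocycleFamilies_apply_mem (h.dualFamily_mem c) s)
    rw [isFace_fullSubcomplex] at h1
    rw [Finset.eq_of_subset_of_card_le h1.2 (by omega)] at hbσ
    exact absurd hb hbσ
  · refine isCobd_of_forall fun σ h1 _ => Pi.single_eq_of_ne ?_ _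
    rintro rfl
    exact ((isFace_fullSubcomplex.1 h1).2.eq_or_ssubset).elim hI' hI

/-- The classes of the multiples of the cochain dual to the glued simplex. -/
def dualClass (c : Finset V → R) : CH R L n := clsFamily R L n ⟨dualFamily s c, h.dualFamily_mem c⟩

/-- For `I ⊋ s`, the coefficient is recovered up to sign by evaluating on `∂(s ∪ {j})` with `j ∈ I \
s`, a cycle of `L_I` by hypothesis 2. -/
theorem dualClass_eq_zero_iff (c : Finset V → R) :
    h.dualClass c = 0 ↔ ∀ I, s ⊂ I → c I = 0 := by
  rw [dualClass, clsFamily_eq_zero_iff]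
  refine ⟨fun hc I hI => ?_, h.isCobd_dualFamily c⟩
  obtain ⟨g, hg⟩ := hc I
  obtain ⟨j, hj, hjs⟩ := Finset.exists_of_ssubset hI
  have hs := h.card_eq
  have h1 : cobd (dualFamily s c I) (insert j s) = 0 := by
    rw [← cobd_cobd g (insert j s)]
    refine cobd_congr fun v hv => hg _ ?_ ?_
    · rw [isFace_fullSubcomplex, h.isFace_iff]
      refine ⟨?_, (Finset.erase_subset _ _).trans (Finset.insert_subset hj hI.1)⟩
      rcases Finset.mem_insert.1 hv with rfl | hv
      · exact Or.inr (Finset.erase_insert hjs)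
      · exact Or.inl (h.isFace_erase j hjs v hv)
    · have := Finset.card_erase_add_one hv
      rw [Finset.card_insert_of_notMem hjs] at this
      omega
  have h2 := cobd_single (Finset.mem_insert_self j s) (c I)
  rw [Finset.erase_insert hjs] at h2
  rw [dualFamily, h2] at h1
  exact eps_smul_eq_zero h1

theorem dualClass_congr {c c' : Finset V → R} (hc : ∀ I, s ⊆ I → c I = c' I) :
    h.dualClass c = h.dualClass c' := by
  refine clsFamily_eq_of_forall fun I σ _ h1 _ => ?_
  by_cases hσ : σ = s
  · subst hσ
    exact congrArg (fun a => (Pi.single σ a : Finset V → R) σ) (hc I h1)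
  · change (Pi.single s (c I) : Finset V → R) σ = (Pi.single s (c' I) : Finset V → R) σ
    rw [Pi.single_eq_of_ne hσ, Pi.single_eq_of_ne hσ]

theorem resCH_dualClass (c : Finset V → R) : resCH R h.le n (h.dualClass c) = 0 := by
  rw [dualClass, resCH_clsFamily, clsFamily_eq_zero_iff]
  refine fun I => isCobd_of_forall fun σ h1 _ => Pi.single_eq_of_ne ?_ _
  rintro rfl
  exact h.not_isFace (isFace_fullSubcomplex.1 h1).1

/-- If `F I` restricts to `δg` on `K_I`, subtracting `δg` leaves a cochain of `L_I` supported at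
`s`. -/
theorem exists_eq_dualClass {z : CH R L n} (hz : resCH R h.le n z = 0) :
    ∃ c, z = h.dualClass c := by
  obtain ⟨F, rfl⟩ := clsFamily_surjective R L n z
  rw [resCH_clsFamily, clsFamily_eq_zero_iff] at hz
  choose g hg using hz
  refine ⟨fun I => F.1 I s - cobd (g I) s, ?_⟩
  rw [dualClass, ← sub_eq_zero, ← map_sub, clsFamily_eq_zero_iff]
  refine fun I => ⟨g I, fun σ h1 h2 => ?_⟩
  rw [isFace_fullSubcomplex, h.isFace_iff] at h1
  change F.1 I σ - (Pi.single s (F.1 I s - cobd (g I) s) : Finset V → R) σ = _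
  by_cases hσ : σ = s
  · subst hσ
    rw [Pi.single_eq_same, sub_sub_cancel]
  · rw [Pi.single_eq_of_ne hσ, sub_zero]
    exact hg I σ (isFace_fullSubcomplex.2 ⟨h1.1.resolve_right hσ, h1.2⟩) h2

theorem isFace_erase_insert {j : V} (hj : j ∉ s) {v : V} (hv : v ∈ insert j s) :
    IsFace (fullSubcomplex L (insert j s)) ((insert j s).erase v) := by
  rw [isFace_fullSubcomplex, h.isFace_iff]
  refine ⟨?_, Finset.erase_subset _ _⟩
  rcases Finset.mem_insert.1 hv with rfl | hv
  · exact Or.inr (Finset.erase_insert hj)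
  · exact Or.inl (h.isFace_erase j hj v hv)

theorem card_insert_eq {j : V} (hj : j ∉ s) : ((insert j s).card : ℤ) = (n : ℤ) + 1 + 1 := by
  rw [Finset.card_insert_of_notMem hj, h.card_eq]
  push_cast
  ring

variable [Fintype V]

theorem dPrime_dualClass (c : Finset V → R) :
    dPrime R L n (h.dualClass c) = (((n : ℤ) + 1).negOnePow : ℤ) • h.dualClass (bd c) := by
  rw [dualClass, dPrime_clsFamily]
  congr 2
  exact Subtype.ext (bd_dualFamily s c)

variable (R) in
/-- The sum of the evaluations on the boundaries of the simplices on `s ∪ {j}`. -/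
def aug : CH R L n →ₗ[R] R :=
  ∑ j : {j // j ∉ s}, evalBoundary R (fullSubcomplex L (insert j.1 s)) n (insert j.1 s)
    (h.card_insert_eq j.2) (fun _ hv => h.isFace_erase_insert j.2 hv) ∘ₗ
      LinearMap.proj (insert j.1 s)

theorem aug_clsFamily (F : cocycleFamilies R L n) :
    h.aug R (clsFamily R L n F) = ∑ j ∈ sᶜ, cobd (F.1 (insert j s)) (insert j s) := by
  rw [aug, LinearMap.sum_apply, Finset.sum_subtype sᶜ (p := fun j => j ∉ s) (by simp)]
  refine Finset.sum_congr rfl fun j _ => ?_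
  rw [LinearMap.comp_apply, LinearMap.proj_apply, evalBoundary_clsFamily]

theorem aug_dualClass (c : Finset V → R) : h.aug R (h.dualClass c) = bd c s := by
  rw [dualClass, aug_clsFamily]
  refine Finset.sum_congr rfl fun j hj => ?_
  have h2 := cobd_single (Finset.mem_insert_self j s) (c (insert j s))
  rwa [Finset.erase_insert (Finset.mem_compl.1 hj)] at h2

/-- The kernel of restriction, completed by the term `I = s`, is contracted by the vertex `v`.
Vanishing of `aug` is the cycle condition at that missing term. -/
theorem exists_dPrime_eq {v : V} (hv : v ∉ s) {y : CH R L n} (h1 : resCH R h.le n y = 0)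
    (h2 : dPrime R L n y = 0) (h3 : h.aug R y = 0) :
    ∃ x, resCH R h.le n x = 0 ∧ dPrime R L n x = y := by
  obtain ⟨c, rfl⟩ := h.exists_eq_dualClass h1
  rw [dPrime_dualClass] at h2
  rw [aug_dualClass] at h3
  have h4 : h.dualClass (bd c) = 0 := by
    rw [← negOnePow_smul_negOnePow_smul ((n : ℤ) + 1) (h.dualClass (bd c)), h2, smul_zero]
  rw [dualClass_eq_zero_iff] at h4
  have h5 : ∀ I, s ⊆ I → bd c I = 0 := fun I hI => by
    rcases hI.eq_or_ssubset with rfl | hI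
    · exact h3
    · exact h4 I hI
  refine ⟨(((n : ℤ) + 1).negOnePow : ℤ) • h.dualClass (coneBd v c), ?_, ?_⟩
  · rw [map_zsmul, resCH_dualClass, smul_zero]
  · rw [map_zsmul, dPrime_dualClass, negOnePow_smul_negOnePow_smul]
    refine h.dualClass_congr fun I hI => ?_
    rw [← bd_coneBd v c I, left_eq_add, coneBd]
    split_ifs with hvI
    · rw [h5, smul_zero]
      -- Because `v ∉ s`, removing `v` stays among the sets containing `s`, where `bd c` vanishes.
      exact fun x hx => Finset.mem_erase.2 ⟨fun hxv => hv (hxv ▸ hx), hI hx⟩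
    · rfl

theorem aug_dPrime_eq_zero_of_resCH_eq_zero {x : CH R L n} (hx : resCH R h.le n x = 0) :
    h.aug R (dPrime R L n x) = 0 := by
  obtain ⟨c, rfl⟩ := h.exists_eq_dualClass hx
  rw [dPrime_dualClass, map_zsmul, aug_dualClass, bd_bd, smul_zero]

theorem dPrime_dualClass_single {v : V} (hv : v ∉ s) :
    dPrime R L n (h.dualClass (Pi.single (insert v s) 1)) = 0 := by
  rw [dPrime_dualClass, (h.dualClass_eq_zero_iff _).2, smul_zero]
  intro I hI
  refine bd_single_eq_zero _ fun i hi hIi => ?_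
  have h1 := Finset.card_lt_card hI
  have h2 := Finset.card_erase_add_one hi
  rw [Finset.card_insert_of_notMem hv, ← hIi] at h2
  omega

theorem aug_dualClass_single {v : V} (hv : v ∉ s) :
    h.aug R (h.dualClass (Pi.single (insert v s) 1)) = eps v (insert v s) • (1 : R) := by
  rw [aug_dualClass]
  have := bd_single_erase (Finset.mem_insert_self v s) (1 : R)
  rwa [Finset.erase_insert hv] at this

theorem aug_dPrime_clsFamily (F : cocycleFamilies R L n) :
    h.aug R (dPrime R L n (clsFamily R L n F)) = (((n : ℤ) + 1).negOnePow : ℤ) •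
      ∑ j ∈ sᶜ, cobd (bd F.1 (insert j s)) (insert j s) := by
  rw [dPrime_clsFamily, map_zsmul, aug_clsFamily]

/-- Up to a global sign, `aug (d' z)` sums over ordered pairs `(j, k)` the terms `ε(k, J) δF_J(s ∪
{j})` with `J = s ∪ {j, k}`. The two orders together make up `δδF_J` at `J`: its other terms are
values of `δF_J` at the faces `J \ {i}`, where the cocycle `F_J` has zero coboundary. -/
theorem aug_dPrime_eq_zero (hK : ∀ j ∉ s, ∀ k ∉ s, j ≠ k → ∀ i ∈ s,
    IsFace K ((insert k (insert j s)).erase i)) (z : CH R L n) :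
    h.aug R (dPrime R L n z) = 0 := by
  obtain ⟨F, rfl⟩ := clsFamily_surjective R L n z
  have key : ∀ j, cobd (bd F.1 (insert j s)) (insert j s) = ∑ k ∈ sᶜ.erase j,
      eps k (insert k (insert j s)) • cobd (F.1 (insert k (insert j s))) (insert j s) := by
    intro j
    rw [← Finset.compl_insert]
    simp only [cobd, bd_apply, Finset.smul_sum]
    rw [Finset.sum_comm]
    exact Finset.sum_congr rfl fun k _ => Finset.sum_congr rfl fun v _ => smul_comm _ _ _
  rw [aug_dPrime_clsFamily]
  simp only [key]
  rw [sum_eq_zero_of_antisymm sᶜ (fun j k => eps k (insert k (insert j s)) •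
    cobd (F.1 (insert k (insert j s))) (insert j s)), smul_zero]
  intro j hj k hk hjk
  rw [Finset.mem_compl] at hj hk
  have hkj : k ∉ insert j s := by simp [hk, hjk.symm]
  have hJ := cobd_cobd (F.1 (insert k (insert j s))) (insert k (insert j s))
  rw [cobd, Finset.sum_insert hkj, Finset.sum_insert hj, Finset.sum_eq_zero, add_zero,
    Finset.erase_insert hkj] at hJ
  · rw [Finset.erase_insert_of_ne hjk.symm, Finset.erase_insert hj] at hJ
    rw [Finset.insert_comm j k s]
    exact hJ
  · intro v hv
    rw [cocycleFamilies_apply_mem F.2 _ _ (isFace_fullSubcomplex.2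
      ⟨(hK j hj k hk hjk v hv).mono h.le, Finset.erase_subset _ _⟩), smul_zero]
    have h1 := Finset.card_erase_add_one (s := insert k (insert j s)) (a := v) (by simp [hv])
    rw [Finset.card_insert_of_notMem hkj] at h1
    have h2 := h.card_insert_eq hj
    omega

theorem finrank_HHDeg_eq_add_one [IsDomain R] (hs : ∃ j, j ∉ s)
    (hK : ∀ j ∉ s, ∀ k ∉ s, j ≠ k → ∀ i ∈ s, IsFace K ((insert k (insert j s)).erase i)) :
    Module.finrank R (HHDeg R L n) = Module.finrank R (HHDeg R K n) + 1 := by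
  obtain ⟨v, hv⟩ := hs
  refine finrank_cohomologyAt_eq_add_one (rank_CH_lt L _) (rank_CH_lt K _)
    (dPrime_dPrime R L _) (dPrime_dPrime R K _) (h.resCH_surjective (by omega))
    (resCH_dPrime R h.le _) (h.aug R) (h.resCH_dualClass _) (h.dPrime_dualClass_single hv) ?_
    (fun x => h.aug_dPrime_eq_zero_of_resCH_eq_zero)
    (fun y => h.exists_dPrime_eq hv) (fun x _ => h.aug_dPrime_eq_zero hK x)
  rw [h.aug_dualClass_single hv]
  exact fun h0 => one_ne_zero (eps_smul_eq_zero h0)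

end IsGluing
end
end MomentAngle

/-! ### Pairs of vertices outside the glued simplex -/

namespace MomentAngle
noncomputable section
universe u
variable {V : Type} [LinearOrder V] {R : Type u} [CommRing R]

namespace IsGluing

variable {K L : PreAbstractSimplicialComplex V} {s : Finset V} {n : ℕ} (h : IsGluing K L s n)
include h

/-- If the join of the boundary of `s` with the edge `{j, k}` is contained in `K`, the full
subcomplex of `K` on `s ∪ {j, k}` is a cone. -/
theorem finrank_reducedCohomology_eq_zero [Nontrivial R] {j k : V} (hj : j ∉ s)
    (hK : ∀ i ∈ s, IsFace K ((insert k (insert j s)).erase i)) :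
    Module.finrank R (ReducedCohomology R (fullSubcomplex K (insert k (insert j s))) n) = 0 := by
  have : Subsingleton (ReducedCohomology R (fullSubcomplex K (insert k (insert j s))) n) := by
    refine subsingleton_of_forall_eq 0 fun x => ?_
    obtain ⟨f, rfl⟩ := cls_surjective R _ _ x
    refine (cls_eq_zero_iff f).2 (isCobd_of_cone j (fun σ h1 _ _ => ?_) f.2)
    rw [isFace_fullSubcomplex] at h1 ⊢
    refine ⟨?_, Finset.insert_subset (by simp) h1.2⟩
    obtain ⟨i, hi, hiσ⟩ := Finset.not_subset.1 (h.not_subset_of_isFace h1.1)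
    refine (hK i hi).subset fun x hx => Finset.mem_erase.2 ?_
    rcases Finset.mem_insert.1 hx with rfl | hx
    · exact ⟨fun hxi => hj (hxi ▸ hi), by simp⟩
    · exact ⟨fun hxi => hiσ (hxi ▸ hx), h1.2 hx⟩
  exact Module.finrank_zero_of_subsingleton

section NotFace

variable {j k : V} (hj : j ∉ s) (hk : k ∉ s) (hjk : j ≠ k)
  (hK : ∀ i ∈ s, ¬ IsFace K ((insert k (insert j s)).erase i))
include hj hk hjk hK

/-- There are no `(n + 1)`-simplices in `L_J`: such a simplex would be `J \ {v}`, which is excluded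
by `hK` if `v ∈ s` and contains `s` otherwise. -/
theorem mem_cocycles (f : Finset V → R) :
    f ∈ cocycles R (fullSubcomplex L (insert k (insert j s))) n := by
  intro τ h1 h2
  exfalso
  rw [isFace_fullSubcomplex] at h1
  have hkj : k ∉ insert j s := by simp [hk, hjk.symm]
  have hc : (insert k (insert j s)).card = n + 3 := by
    rw [Finset.card_insert_of_notMem hkj, Finset.card_insert_of_notMem hj, h.card_eq]
  have hτ : IsFace K τ := h.isFace_of_card_ne h1.1 (by omega)
  obtain ⟨v, hv, hvτ⟩ := Finset.exists_of_ssubset (s₁ := τ) (s₂ := insert k (insert j s))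
    (h1.2.ssubset_of_ne fun h3 => by rw [h3] at h2; omega)
  have hτv : τ = (insert k (insert j s)).erase v := by
    refine Finset.eq_of_subset_of_card_le
      (fun x hx => Finset.mem_erase.2 ⟨fun h3 => hvτ (h3 ▸ hx), h1.2 hx⟩) ?_
    have := Finset.card_erase_add_one hv
    omega
  by_cases hvs : v ∈ s
  · exact hK v hvs (hτv ▸ hτ)
  · refine h.not_subset_of_isFace hτ fun x hx => ?_
    rw [hτv]
    exact Finset.mem_erase.2 ⟨fun h3 => hvs (h3 ▸ hx), by simp [hx]⟩

omit hjk hK in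
-- Evaluation on the suspension of `∂s` with apexes `j` and `k`. The cone over `k` gives `δg(s) =
-- 0`, although `s` is not a face of `K`; the cone over `j` then isolates the single remaining
-- value.
theorem apply_eq_zero_of_isCobd {a : V} (ha : a ∈ s) {f g : Finset V → R}
    (hg : ∀ σ, IsFace (fullSubcomplex K (insert k (insert j s))) σ →
      (σ.card : ℤ) = (n : ℤ) + 1 → f σ = cobd g σ)
    (h1 : ∀ w ∈ s, f ((insert k s).erase w) = 0)
    (h2 : ∀ w ∈ s, w ≠ a → f ((insert j s).erase w) = 0) :
    f ((insert j s).erase a) = 0 ∧ cobd g s = 0 := by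
  have hface : ∀ l ∉ s, insert l s ⊆ insert k (insert j s) → ∀ w ∈ s,
      f ((insert l s).erase w) = cobd g ((insert l s).erase w) := by
    intro l hl hls w hw
    refine hg _ (isFace_fullSubcomplex.2
      ⟨h.isFace_erase l hl w hw, (Finset.erase_subset _ _).trans hls⟩) ?_
    have h3 := Finset.card_erase_add_one (Finset.mem_insert_of_mem hw : w ∈ insert l s)
    have h4 := h.card_insert_eq hl
    omega
  have hsk : insert k s ⊆ insert k (insert j s) :=
    Finset.insert_subset_insert _ (Finset.subset_insert _ _)
  have hgs : cobd g s = 0 := by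
    have h3 := cobd_cobd g (insert k s)
    rw [cobd_eq_single (Finset.mem_insert_self k s), Finset.erase_insert hk] at h3
    · exact eps_smul_eq_zero h3
    · intro w hw hwk
      have hw' := Finset.mem_of_mem_insert_of_ne hw hwk
      rw [← hface k hk hsk w hw', h1 w hw']
  refine ⟨?_, hgs⟩
  have h3 := cobd_cobd g (insert j s)
  rw [cobd_eq_single (Finset.mem_insert_of_mem ha)] at h3
  · rw [hface j hj (Finset.subset_insert _ _) a ha]
    exact eps_smul_eq_zero h3
  · intro w hw hwa
    by_cases hwj : w = j
    · rw [hwj, Finset.erase_insert hj, hgs]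
    · have hw' := Finset.mem_of_mem_insert_of_ne hw hwj
      rw [← hface j hj (Finset.subset_insert _ _) w hw', h2 w hw' hwa]

variable [Fintype V] [IsDomain R]

theorem one_le_finrank_reducedCohomology :
    1 ≤ Module.finrank R (ReducedCohomology R (fullSubcomplex K (insert k (insert j s))) n) := by
  obtain ⟨a, ha, -⟩ := h.exists_ne j
  have hmem := cocycles_mono (fullSubcomplex_le h.le _) (h.mem_cocycles hj hk hjk hK
    (Pi.single ((insert j s).erase a) 1 : Finset V → R))
  refine le_finrank_of_linearIndependent (rank_reducedCohomology_lt _ _)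
    (v := fun _ : Fin 1 => cls R _ _ ⟨_, hmem⟩) ?_
  rw [Fintype.linearIndependent_iff]
  intro c hc i
  rw [Fin.sum_univ_one, ← map_smul, cls_eq_zero_iff] at hc
  obtain ⟨g, hg⟩ := hc
  have := (h.apply_eq_zero_of_isCobd hj hk ha hg (fun w hw => ?_) (fun w hw hwa => ?_)).1
  · simpa [Subsingleton.elim i 0] using this
  · have h1 : (insert k s).erase w ≠ (insert j s).erase a := fun h2 => by
      have := Finset.ext_iff.1 h2 k
      grind
    simp [Pi.single_eq_of_ne h1]
  · have h1 : (insert j s).erase w ≠ (insert j s).erase a := fun h2 => by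
      have := Finset.ext_iff.1 h2 a
      grind
    simp [Pi.single_eq_of_ne h1]

/-- Otherwise `∂(J \ {a})` is a cycle of `K_J` besides the suspension of `∂s`. The dual cochains of
`τ` and `ρ` then give independent classes: the suspension contains `τ` but not `ρ`, and `∂(J \ {a})`
contains `ρ`. -/
theorem exists_not_isFace
    (hr : Module.finrank R (ReducedCohomology R (fullSubcomplex K (insert k (insert j s))) n) ≤ 1)
    {a : V} (ha : a ∈ s) :
    ∃ l ∈ s, l ≠ a ∧ ¬ IsFace K (((insert k (insert j s)).erase a).erase l) := by
  by_contra! hcon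
  obtain ⟨l, hl, hla⟩ := h.exists_ne a
  have hmem : ∀ f : Finset V → R, f ∈ cocycles R (fullSubcomplex K (insert k (insert j s))) n :=
    fun f => cocycles_mono (fullSubcomplex_le h.le _) (h.mem_cocycles hj hk hjk hK f)
  let τ := (insert j s).erase a
  let ρ := ((insert k (insert j s)).erase a).erase l
  have hτρ : τ ≠ ρ := fun h2 => by
    have := Finset.ext_iff.1 h2 k
    grind
  refine absurd (le_finrank_of_linearIndependent (rank_reducedCohomology_lt _ _)
    (v := ![cls R _ _ ⟨Pi.single τ 1, hmem _⟩, cls R _ _ ⟨Pi.single ρ 1, hmem _⟩]) ?_)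
    (by omega : ¬ 2 ≤ _)
  rw [LinearIndependent.pair_iff]
  intro x y hxy
  rw [← map_smul, ← map_smul, ← map_add, cls_eq_zero_iff] at hxy
  obtain ⟨g, hg⟩ := hxy
  let f : Finset V → R := x • (Pi.single τ 1 : Finset V → R) + y • (Pi.single ρ 1 : Finset V → R)
  change ∀ σ, _ → _ → f σ = cobd g σ at hg
  have hf : ∀ σ, σ ≠ τ → σ ≠ ρ → f σ = 0 := fun σ h1 h2 => by
    simp [f, Pi.single_eq_of_ne h1, Pi.single_eq_of_ne h2]
  have hfτ : f τ = x := by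
    simp [f, Pi.single_eq_of_ne hτρ]
  have hfρ : f ρ = y := by
    simp [f, Pi.single_eq_of_ne hτρ.symm]
  have hx : x = 0 := by
    rw [← hfτ]
    refine (h.apply_eq_zero_of_isCobd hj hk ha hg (fun w hw => ?_) (fun w hw hwa => ?_)).1
    · refine hf _ (fun h2 => ?_) (fun h2 => ?_)
      · have := Finset.ext_iff.1 h2 k
        grind
      · have := Finset.ext_iff.1 h2 j
        grind
    · refine hf _ (fun h2 => ?_) (fun h2 => ?_)
      · have := Finset.ext_iff.1 h2 a
        grind
      · have := Finset.ext_iff.1 h2 k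
        grind
  refine ⟨hx, ?_⟩
  have hkj : k ∉ insert j s := by simp [hk, hjk.symm]
  have hcard : (insert k (insert j s)).card = n + 3 := by
    rw [Finset.card_insert_of_notMem hkj, Finset.card_insert_of_notMem hj, h.card_eq]
  have hface : ∀ w ∈ (insert k (insert j s)).erase a,
      IsFace K (((insert k (insert j s)).erase a).erase w) →
      f (((insert k (insert j s)).erase a).erase w) = cobd g (((insert k (insert j s)).erase a).erase w) := by
    intro w hw hwK
    refine hg _ (isFace_fullSubcomplex.2
      ⟨hwK, (Finset.erase_subset _ _).trans (Finset.erase_subset _ _)⟩) ?_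
    have h1 := Finset.card_erase_add_one hw
    have h2 := Finset.card_erase_add_one (s := insert k (insert j s)) (a := a) (by simp [ha])
    omega
  have hlJ : l ∈ (insert k (insert j s)).erase a := by simp [hla, hl]
  -- Evaluation on `∂(J \ {a})`: now that `x = 0`, the only facet on which `f` can be nonzero is
  -- `ρ`.
  have h3 := cobd_cobd g ((insert k (insert j s)).erase a)
  rw [cobd_eq_single hlJ] at h3
  · rw [← hfρ, hface l hlJ (hcon l hl hla)]
    exact eps_smul_eq_zero h3
  · intro w hw hwl
    by_cases hws : w ∈ s
    · rw [← hface w hw (hcon w hws (Finset.ne_of_mem_erase hw))]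
      refine hf _ (fun h2 => ?_) (fun h2 => ?_)
      · have := Finset.ext_iff.1 h2 k
        grind
      · have := Finset.ext_iff.1 h2 l
        grind
    · by_cases hwk : w = k
      · have h4 : ((insert k (insert j s)).erase a).erase w = τ := by
          rw [hwk, Finset.erase_right_comm, Finset.erase_insert hkj]
        rw [← hface w hw (h4 ▸ h.isFace_erase j hj a ha), h4, hfτ, hx]
      · have hwj : w = j := by
          simp only [Finset.mem_erase, Finset.mem_insert] at hw
          tauto
        have h4 : ((insert k (insert j s)).erase a).erase w = (insert k s).erase a := by
          rw [hwj, Finset.erase_right_comm, Finset.erase_insert_of_ne hjk.symm,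
            Finset.erase_insert hj]
        rw [← hface w hw (h4 ▸ h.isFace_erase k hk a ha), h4]
        refine hf _ (fun h2 => ?_) (fun h2 => ?_)
        · have := Finset.ext_iff.1 h2 k
          grind
        · have := Finset.ext_iff.1 h2 j
          grind

/-- The witness is the dual cochain of `τ = (s ∪ {j}) \ {a}`, placed in the summand `J = s ∪ {j,
k}`. Its restriction to each `K_{J \ {i}}` is null, while its differential in `L` has a unit as
augmentation. -/
theorem finrank_HHDeg_add_one_eq
    (hr : Module.finrank R (ReducedCohomology R (fullSubcomplex K (insert k (insert j s))) n) ≤ 1) :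
    Module.finrank R (HHDeg R L n) + 1 = Module.finrank R (HHDeg R K n) := by
  obtain ⟨a, ha, -⟩ := h.exists_ne j
  obtain ⟨l, hl, hla, hlK⟩ := h.exists_not_isFace hj hk hjk hK hr ha
  have hkj : k ∉ insert j s := by simp [hk, hjk.symm]
  have hmem := h.mem_cocycles hj hk hjk hK (Pi.single ((insert j s).erase a) 1 : Finset V → R)
  have hmemK := cocycles_mono (fullSubcomplex_le h.le _) hmem
  refine finrank_cohomologyAt_add_one_eq (rank_CH_lt L _) (rank_CH_lt K _)
    (dPrime_dPrime R L _) (dPrime_dPrime R K _) (h.resCH_surjective (by omega))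
    (resCH_dPrime R h.le _) (h.aug R) (h.resCH_dualClass _) (h.dPrime_dualClass_single hj) ?_
    (fun x => h.aug_dPrime_eq_zero_of_resCH_eq_zero)
    (fun y => h.exists_dPrime_eq hj)
    ⟨clsFamily R L n ⟨_, single_mem_cocycleFamilies hmem⟩, ?_, ?_⟩
  · rw [h.aug_dualClass_single hj]
    exact fun h0 => one_ne_zero (eps_smul_eq_zero h0)
  · rw [resCH_dPrime, resCH_clsFamily]
    refine dPrime_single_eq_zero hmemK fun i hi => ?_
    by_cases hiτ : i ∈ (insert j s).erase a
    · refine isCobd_of_forall fun σ h1 _ => Pi.single_eq_of_ne ?_ _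
      rintro rfl
      exact Finset.notMem_erase i _ ((isFace_fullSubcomplex.1 h1).2 hiτ)
    by_cases hik : i = k
    -- For `i = k`, the complex `K_{s ∪ {j}}` is the cone over `∂s` with apex `j`.
    · refine isCobd_of_cone j (fun σ h1 _ hjσ => ?_)
        (cocycles_mono (fullSubcomplex_mono K (Finset.erase_subset _ _)) hmemK)
      rw [hik, Finset.erase_insert hkj, isFace_fullSubcomplex] at h1 ⊢
      obtain ⟨b, hb, hbσ⟩ := Finset.not_subset.1 (h.not_subset_of_isFace h1.1)
      refine ⟨(h.isFace_erase j hj b hb).subset fun x hx => Finset.mem_erase.2 ?_,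
        Finset.insert_subset (by simp) h1.2⟩
      rcases Finset.mem_insert.1 hx with rfl | hx
      · exact ⟨fun hxb => hj (hxb ▸ hb), by simp⟩
      · exact ⟨fun hxb => hbσ (hxb ▸ hx), h1.2 hx⟩
    · have hia : i = a := by
        simp only [Finset.mem_erase, Finset.mem_insert] at hi hiτ
        tauto
      subst hia
      have hlτ : l ∈ (insert j s).erase i := by simp [hla, hl]
      -- In `K_{J \ {i}}` the simplex `τ \ {l}` is a facet of `τ` alone, since adding `k` instead of
      -- `l` gives the non-face found above. The dual cochain of `τ` is thus the coboundary of that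
      -- of `τ \ {l}`, with the sign `ε(l, τ)`.
      refine ⟨Pi.single (((insert j s).erase i).erase l) (eps l ((insert j s).erase i) • 1),
        fun σ h1 h2 => ?_⟩
      rw [isFace_fullSubcomplex] at h1
      by_cases hσ : σ = (insert j s).erase i
      · rw [hσ, Pi.single_eq_same, cobd_single hlτ, eps_smul_eps_smul]
      · rw [Pi.single_eq_of_ne hσ, cobd_single_eq_zero]
        intro v hv hvσ
        have h3 : σ = insert v (((insert j s).erase i).erase l) := by
          rw [← hvσ, Finset.insert_erase hv]
        have hvJ := h1.2 hv
        have hvl : v = l ∨ v = k := by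
          have hv' : v ∉ ((insert j s).erase i).erase l := hvσ ▸ Finset.notMem_erase v σ
          simp only [Finset.mem_erase, Finset.mem_insert] at hvJ hv'
          tauto
        rcases hvl with rfl | rfl
        · exact hσ (by rw [h3, Finset.insert_erase hlτ])
        · refine hlK ?_
          have h4 : σ = ((insert v (insert j s)).erase i).erase l := by
            rw [h3]
            grind
          exact h4 ▸ h1.1
  -- Only `s ∪ {j}` contributes: `τ` contains `j`, so it is not a facet of `s ∪ {k}`, and the other
  -- sets `s ∪ {i}` do not arise from `J` by deleting a vertex.
  · rw [aug_dPrime_clsFamily, Finset.sum_eq_single_of_mem j (by simpa using hj)]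
    · have h1 := bd_single_erase (Finset.mem_insert_self k (insert j s))
        (Pi.single ((insert j s).erase a) 1 : Finset V → R)
      rw [Finset.erase_insert hkj] at h1
      dsimp only
      rw [h1, cobd_smul, cobd_single (Finset.mem_insert_of_mem ha)]
      intro h0
      have h5 := congrArg (fun x : R => (((n : ℤ) + 1).negOnePow : ℤ) • x) h0
      simp only [negOnePow_smul_negOnePow_smul, smul_zero] at h5
      exact one_ne_zero (eps_smul_eq_zero (eps_smul_eq_zero h5))
    · intro i hi hij
      rw [Finset.mem_compl] at hi
      dsimp only
      by_cases hik : i = k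
      · subst hik
        have h1 := bd_single_erase (I := insert i (insert j s)) (i := j) (by simp)
          (Pi.single ((insert j s).erase a) 1 : Finset V → R)
        rw [Finset.erase_insert_of_ne hjk.symm, Finset.erase_insert hj] at h1
        rw [h1, cobd_smul, cobd_single_eq_zero, smul_zero]
        intro v _ h2
        have := Finset.ext_iff.1 h2 j
        grind
      · rw [bd_single_eq_zero]
        · exact cobd_eq_zero fun _ _ => rfl
        · intro b _ h2
          have := Finset.ext_iff.1 h2 i
          grind

end NotFace

end IsGluing
end
end MomentAngle

/-! ### Summation over the degrees and the theorem -/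

namespace MomentAngle
universe u

theorem finrank_HH_eq_sum {R : Type u} [CommRing R] [IsDomain R] {V : Type} [LinearOrder V]
    [Fintype V] (K : AbstractSimplicialComplex V) :
    Module.finrank R (HH R K) = ∑ p ∈ Finset.Ico (-1) (Fintype.card V : ℤ),
      Module.finrank R (HHDeg R K.toPreAbstractSimplicialComplex p) :=
  finrank_directSum_eq_sum _ (fun p => rank_cohomologyAt_lt (rank_CH_lt _ p) _) _ fun p hp =>
    subsingleton_HHDeg (by
      rw [Finset.mem_Ico] at hp
      omega)

theorem isGluing_glueSimplex {V : Type} [LinearOrder V] {K : AbstractSimplicialComplex V}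
    {s : Finset V} {n : ℕ} (hn : 1 ≤ n) (hc : s.card = n + 1) (hs : ∃ j, j ∉ s)
    (h1 : s ∉ K.faces) (h2 : ∀ j ∉ s, ∀ i ∈ s, (insert j s).erase i ∈ K.faces) :
    IsGluing K.toPreAbstractSimplicialComplex (glueSimplex K s).toPreAbstractSimplicialComplex
      s n where
  le := fun _ hσ => Or.inl hσ
  isFace_iff σ := by
    constructor
    · rintro (h | h | ⟨h, hσ⟩)
      · exact Or.inl (Or.inl h)
      · exact Or.inl (Or.inr h)
      · by_cases hσs : σ = s
        · exact Or.inr hσs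
        · obtain ⟨j, hj⟩ := hs
          obtain ⟨i, hi, hiσ⟩ := Finset.exists_of_ssubset (hσ.ssubset_of_ne hσs)
          refine Or.inl (IsFace.subset (Or.inr (h2 j hj i hi)) fun x hx => Finset.mem_erase.2 ?_)
          exact ⟨fun hxi => hiσ (hxi ▸ hx), Finset.mem_insert_of_mem (hσ hx)⟩
    · rintro ((h | h) | rfl)
      · exact Or.inl h
      · exact Or.inr (Or.inl h)
      · exact Or.inr (Or.inr ⟨Finset.card_pos.1 (by omega), subset_rfl⟩)
  not_isFace := by
    rintro (h | h)
    · rw [h, Finset.card_empty] at hc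
      omega
    · exact h1 h
  card_eq := hc
  pos := hn
  isFace_erase j hj i hi := Or.inr (h2 j hj i hi)

/-- Degrees other than `n - 1` and `n` contribute equally, and degree `n - 1` always loses one. The
comparison in degree `n` is left open, and both sides are arranged to avoid subtraction in `ℕ`. -/
theorem IsGluing.finrank_HH_eq {R : Type u} [CommRing R] [IsDomain R] {V : Type} [LinearOrder V]
    [Fintype V] {K L : AbstractSimplicialComplex V} {s : Finset V} {n : ℕ}
    (h : IsGluing K.toPreAbstractSimplicialComplex L.toPreAbstractSimplicialComplex s n)
    (hs : ∃ j, j ∉ s) :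
    Module.finrank R (HH R L) + 1 + Module.finrank R (HHDeg R K.toPreAbstractSimplicialComplex n) =
      Module.finrank R (HH R K) + Module.finrank R (HHDeg R L.toPreAbstractSimplicialComplex n) := by
  have hcard : (n : ℤ) < Fintype.card V := by
    have := s.card_le_univ
    have := h.card_eq
    omega
  have h1 : (n : ℤ) ∈ Finset.Ico (-1) (Fintype.card V : ℤ) := Finset.mem_Ico.2 (by omega)
  have h2 : (n : ℤ) - 1 ∈ (Finset.Ico (-1) (Fintype.card V : ℤ)).erase n :=
    Finset.mem_erase.2 ⟨by omega, Finset.mem_Ico.2 (by omega)⟩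
  have h3 := h.finrank_HHDeg_pred (R := R) hs
  rw [finrank_HH_eq_sum, finrank_HH_eq_sum, ← Finset.add_sum_erase _ _ h1,
    ← Finset.add_sum_erase _ _ h2, ← Finset.add_sum_erase _ _ h1, ← Finset.add_sum_erase _ _ h2,
    Finset.sum_congr rfl fun p hp => h.finrank_HHDeg_eq (R := R)
      (Finset.ne_of_mem_erase (Finset.mem_of_mem_erase hp)) (Finset.ne_of_mem_erase hp)]
  omega

theorem card_initialFace {m n : ℕ} (hm : n + 2 ≤ m) : (initialFace m n).card = n + 1 := by
  have : initialFace m n = Finset.Iio (⟨n + 1, by omega⟩ : Fin m) := by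
    ext i
    simp [initialFace, Fin.lt_def]
  rw [this, Fin.card_Iio]

theorem notMem_initialFace {m n : ℕ} {j : Fin m} : j ∉ initialFace m n ↔ n + 1 ≤ j.val := by
  simp [initialFace]

end MomentAngle

/-- The vertices `1, …, m` are the elements `0, …, m - 1` of `Fin m`; so `i ≤ n + 1` reads
`i ∈ [n+1]`, and `n + 2 ≤ j ≤ m` reads `n + 1 ≤ j.val`. -/
theorem theorem1 {R : Type*} [CommRing R] [IsDomain R] (m n : ℕ) (hn : 1 ≤ n) (hm : n + 2 ≤ m)
    (K : AbstractSimplicialComplex (Fin m))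
    (h1 : MomentAngle.initialFace m n ∉ K.faces)
    (h2 : ∀ j : Fin m, n + 1 ≤ j.val → ∀ i ∈ MomentAngle.initialFace m n,
      (MomentAngle.initialFace m n ∪ {j}) \ {i} ∈ K.faces)
    (h3 : ∀ j k : Fin m, n + 1 ≤ j.val → j < k →
      Module.finrank R (MomentAngle.ReducedCohomology R
        (MomentAngle.fullSubcomplex K.toPreAbstractSimplicialComplex
          (MomentAngle.initialFace m n ∪ {j, k})) n) ≤ 1)
    (h4 : ∀ j k : Fin m, n + 1 ≤ j.val → j < k →
      (∀ i ∈ MomentAngle.initialFace m n,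
        (MomentAngle.initialFace m n ∪ {j, k}) \ {i} ∈ K.faces) ∨
      (∀ i ∈ MomentAngle.initialFace m n,
        (MomentAngle.initialFace m n ∪ {j, k}) \ {i} ∉ K.faces)) :
    ((∃ j k : Fin m, n + 1 ≤ j.val ∧ j < k ∧
        Module.finrank R (MomentAngle.ReducedCohomology R
          (MomentAngle.fullSubcomplex K.toPreAbstractSimplicialComplex
            (MomentAngle.initialFace m n ∪ {j, k})) n) = 1) →
      (Module.finrank R
          (MomentAngle.HH R (MomentAngle.glueSimplex K (MomentAngle.initialFace m n))) : ℤ) =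
        (Module.finrank R (MomentAngle.HH R K) : ℤ) - 2) ∧
    ((¬ ∃ j k : Fin m, n + 1 ≤ j.val ∧ j < k ∧
        Module.finrank R (MomentAngle.ReducedCohomology R
          (MomentAngle.fullSubcomplex K.toPreAbstractSimplicialComplex
            (MomentAngle.initialFace m n ∪ {j, k})) n) = 1) →
      Module.finrank R
          (MomentAngle.HH R (MomentAngle.glueSimplex K (MomentAngle.initialFace m n))) =
        Module.finrank R (MomentAngle.HH R K)) := by
  open MomentAngle in
  have hc := card_initialFace hm
  have hs : ∃ j, j ∉ initialFace m n :=
    ⟨⟨n + 1, by omega⟩, notMem_initialFace.2 le_rfl⟩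
  have e1 : ∀ (j i : Fin m), (initialFace m n ∪ {j}) \ {i} =
      (insert j (initialFace m n)).erase i := fun j i => by
    ext x
    simp
    tauto
  have e2 : ∀ j k : Fin m, initialFace m n ∪ {j, k} = insert k (insert j (initialFace m n)) :=
    fun j k => by
      ext x
      simp
      tauto
  have e3 : ∀ j k i : Fin m, (initialFace m n ∪ {j, k}) \ {i} =
      (insert k (insert j (initialFace m n))).erase i := fun j k i => by
    rw [e2, Finset.sdiff_singleton_eq_erase]
  simp only [e1] at h2
  simp only [e3] at h4
  have h := isGluing_glueSimplex hn hc hs h1 fun j hj => h2 j (notMem_initialFace.1 hj)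
  have key := h.finrank_HH_eq (R := R) hs
  have hne : ∀ (j k i : Fin m), i ∈ initialFace m n → n + 1 ≤ j.val → j < k →
      (insert k (insert j (initialFace m n))).erase i ≠ ∅ := fun j k i hi hj hjk h0 => by
    have : j ∈ (insert k (insert j (initialFace m n))).erase i :=
      Finset.mem_erase.2 ⟨fun h' => notMem_initialFace.2 hj (h' ▸ hi), by simp⟩
    rw [h0] at this
    exact Finset.notMem_empty j this
  constructor
  · rintro ⟨j, k, hj, hjk, hr⟩
    rw [e2] at hr
    -- Rank one rules out the first alternative, in which `K_J` is a cone with apex `j`.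
    rcases h4 j k hj hjk with hK | hK
    · rw [h.finrank_reducedCohomology_eq_zero (notMem_initialFace.2 hj)
        fun i hi => Or.inr (hK i hi)] at hr
      exact absurd hr zero_ne_one
    · have := h.finrank_HHDeg_add_one_eq (R := R) (notMem_initialFace.2 hj)
        (notMem_initialFace.2 (hj.trans hjk.le)) hjk.ne
        (fun i hi h0 => h0.elim (hne j k i hi hj hjk) (hK i hi)) hr.le
      omega
  · intro hno
    have hK : ∀ j k : Fin m, n + 1 ≤ j.val → j < k → ∀ i ∈ initialFace m n,
        IsFace K.toPreAbstractSimplicialComplex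
          ((insert k (insert j (initialFace m n))).erase i) := fun j k hj hjk => by
      rcases h4 j k hj hjk with hK | hK
      · exact fun i hi => Or.inr (hK i hi)
      -- In the second alternative the suspension class makes the rank at least one, hence exactly
      -- one by `h3`.
      · refine absurd ⟨j, k, hj, hjk, le_antisymm (h3 j k hj hjk) ?_⟩ hno
        rw [e2]
        exact h.one_le_finrank_reducedCohomology (notMem_initialFace.2 hj)
          (notMem_initialFace.2 (hj.trans hjk.le)) hjk.ne
          (fun i hi h0 => h0.elim (hne j k i hi hj hjk) (hK i hi))
    have := h.finrank_HHDeg_eq_add_one (R := R) hs fun j hj k hk hjk i hi => by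
      rcases lt_or_gt_of_ne hjk with hlt | hlt
      · exact hK j k (notMem_initialFace.1 hj) hlt i hi
      · rw [Finset.insert_comm]
        exact hK k j (notMem_initialFace.1 hk) hlt i hi
    omega
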